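/- Let $(X_t,Y_t)_{t\ge 1}$ be i.i.d. copies of a pair $(X,Y)$ with values in $[0,1]^d\times\{0,1\}$, let $\mathcal D_0$ be a finite holdout sample of labelled examples that is independent of $(X_t,Y_t)_{t\ge1}$, and put $\mathcal F_t=\sigma(\mathcal D_0,(X_k,Y_k)_{1\le k\le t})$. Let $\mathrm{lfdr}(x)=\mathbb P(Y=0\mid X=x)$ and $W(x)=1-\mathrm{lfdr}(x)$. Assume that, for some $0\le\kappa<B^*\le 1$, the random variable $W(X)$ has a density supported in $[\kappa,B^*]$ that is continuous on $[\kappa,B^*]$ and positive on $(\kappa,B^*)$. For every $t\ge 1$ let $\widehat{\mathrm{lfdr}}_t:[0,1]^d\to[0,1]$ be an $\mathcal F_{t-1}$-measurable random function (jointly measurable in $(\omega,x)$), and assume that there are $\nu_0>0$, $\nu>0$ and $C_1>0$ such that, for all $t$ large enough, $$\mathbb P\Big(\mathbb E\big[|\widehat{\mathrm{lfdr}}_t(X_t)-\mathrm{lfdr}(X_t)|\,\big|\,\mathcal F_{t-1}\big]\ge C_1(\log t)^{\nu_0}t^{-\nu}\Big)\le\frac{3}{\pi^2t^3}.$$ Let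 $\alpha\in(0,1)$ satisfy $1-B^*<\alpha<\mathbb P(Y=0)$. Let $\gamma_j=c\,j^{-\beta}$ for $j\ge1$, with $c>0$ and $\beta\in(1/2,1)$, and let $q_1\in[0,1-\alpha]$. The online conformal testing procedure rejects the null hypothesis "$Y_t=0$" when $S_t=1$, where $S_t=\mathbf 1\{\widehat{\mathrm{lfdr}}_t(X_t)<1-q_t\}$, and its thresholds are updated by $$q_{t+1}=q_t+\gamma_{J(t)}\big(\mathbf 1\{Y_t=0\}\mathbf 1\{q_t\ge 0\}+\mathbf 1\{q_t<0\}-\alpha\big)S_t,\qquad J(t)=1+\sum_{i=1}^{t-1}S_i .$$ Let $$\delta=\inf_{q\in[0,B^*)}\ \inf_{t\ge1}\ \mathbb P\Big(\sup_{T\ge t}q_T>q\Big)$$ and let $\mathrm{IER}_t=\mathbb P(Y_t=0\mid S_t=1,\mathcal F_{t-1})$ be the instantaneous false discovery rate (equal to $0$ by convention where $\mathbb P(S_t=1\mid\mathcal F_{t-1})=0$). Then there is exactly one $q^0_\alpha\in(\kappa,1-\alpha)$ with $\mathbb E[W(X)\mid W(X)>q^0_\alpha]=1-\alpha$, and for every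 $\delta'>\delta$ there exist $T_0\ge1$ and $C_0>0$ such that, for all $t\ge T_0$, $$\mathbb P\Big(|\mathrm{IER}_t-\alpha|+|q_t-q^0_\alpha|\le C_0\big(\rho(t)+(\log t)^{\nu_0/2}t^{-\nu/2}\big)\Big)\ \ge\ 1-\delta'-\frac{C_0}{t},\qquad \rho(t)=(\log t)^{1/2}t^{1/2-\beta}+t^{\beta-1}.$$ -/

import Mathlib

open MeasureTheory ProbabilityTheory

noncomputable section

namespace OnlineTesting

/-- The feature space `[0,1]^d`. -/
abbrev Feature (d : ℕ) : Type := Fin d → Set.Icc (0 : ℝ) 1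

/-- A labelled example `(x, y)`; the label `0` means that the null hypothesis is true. -/
abbrev Example (d : ℕ) : Type := Feature d × Fin 2

/-- The local false discovery rate `lfdr(x) = P(Y = 0 | X = x)` when `(X, Y)` has law `μ`. -/
def lfdr {d : ℕ} (μ : Measure (Example d)) [IsFiniteMeasure μ] (x : Feature d) : ℝ :=
  (μ.condKernel x).real {0}

/-- The optimal test statistic `W(x) = 1 - lfdr(x)`. -/
def oracleStat {d : ℕ} (μ : Measure (Example d)) [IsFiniteMeasure μ] (x : Feature d) : ℝ :=
  1 - lfdr μ x

/-- `W(X)` has a density that is supported in `[κ, Bs]`, continuous on `[κ, Bs]` and positive on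
`(κ, Bs)`. -/
def HasContinuousDensityOn {d : ℕ} (μ : Measure (Example d)) [IsFiniteMeasure μ] (κ Bs : ℝ) :
    Prop :=
  ∃ f : ℝ → ℝ,
    (μ.map fun z => oracleStat μ z.1) = volume.withDensity (fun w => ENNReal.ofReal (f w)) ∧
    ContinuousOn f (Set.Icc κ Bs) ∧ (∀ w ∈ Set.Ioo κ Bs, 0 < f w) ∧ ∀ w ∉ Set.Icc κ Bs, f w = 0

/-- `E[W(X) | W(X) > q]`. -/
def meanAbove {d : ℕ} (μ : Measure (Example d)) [IsFiniteMeasure μ] (q : ℝ) : ℝ :=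
  ∫ z, oracleStat μ z.1 ∂(cond μ {z | q < oracleStat μ z.1})

section Procedure

variable {Ω : Type*} {d n : ℕ}

/-- The `σ`-field `𝓕_t` generated by the holdout sample `D` and by `(X_k, Y_k)`, `1 ≤ k ≤ t`. -/
abbrev history (D : Fin n → Ω → Example d) (X : ℕ → Ω → Feature d) (Y : ℕ → Ω → Fin 2) (t : ℕ) :
    MeasurableSpace Ω :=
  (⨆ i : Fin n, MeasurableSpace.comap (D i) inferInstance) ⊔
    ⨆ k ∈ Set.Icc 1 t, MeasurableSpace.comap (fun ω => (X k ω, Y k ω)) inferInstance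

/-- The reaction: an error (`y = 0`, that is `y ∉ {1}`) counts as `1`, and every negative threshold
triggers the value `1`. -/
def react (y : Fin 2) (q : ℝ) : ℝ :=
  if q < 0 ∨ y = 0 then 1 else 0

/-- The pair `(q_t, J(t))` of the current threshold and of one plus the number of selections before
time `t`, along a path `h t` of estimated local fdr values at the observed features and a path
`y t` of labels. Time starts at `t = 1`; the value at `0` is a placeholder. -/
def sciState (α : ℝ) (γ : ℕ → ℝ) (q₁ : ℝ) (h : ℕ → ℝ) (y : ℕ → Fin 2) : ℕ → ℝ × ℕ
  | 0 => (q₁, 1)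
  | 1 => (q₁, 1)
  | t + 2 =>
    let s := sciState α γ q₁ h y (t + 1)
    if h (t + 1) < 1 - s.1 then
      (s.1 + γ s.2 * (react (y (t + 1)) s.1 - α), s.2 + 1)
    else s

/-- The random threshold `q_t` of the procedure with estimators `lfdrHat`. -/
def threshold (α : ℝ) (γ : ℕ → ℝ) (q₁ : ℝ) (lfdrHat : ℕ → Ω → Feature d → ℝ)
    (X : ℕ → Ω → Feature d) (Y : ℕ → Ω → Fin 2) (t : ℕ) (ω : Ω) : ℝ :=
  (sciState α γ q₁ (fun k => lfdrHat k ω (X k ω)) (fun k => Y k ω) t).1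

/-- The event `{S_t(X_t) = 1}` that the null hypothesis is rejected at time `t`. -/
def selected (α : ℝ) (γ : ℕ → ℝ) (q₁ : ℝ) (lfdrHat : ℕ → Ω → Feature d → ℝ)
    (X : ℕ → Ω → Feature d) (Y : ℕ → Ω → Fin 2) (t : ℕ) : Set Ω :=
  {ω | lfdrHat t ω (X t ω) < 1 - threshold α γ q₁ lfdrHat X Y t ω}

/-- `P(A | S, m)`, as the quotient `P(A ∩ S | m) / P(S | m)`; it is `0` where `P(S | m) = 0`. -/
def condProbGiven [mΩ : MeasurableSpace Ω] (P : Measure Ω) (A S : Set Ω) (m : MeasurableSpace Ω)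
    (ω : Ω) : ℝ :=
  (condExp m P ((A ∩ S).indicator fun _ => (1 : ℝ))) ω /
    (condExp m P (S.indicator fun _ => (1 : ℝ))) ω

/-- The instantaneous false discovery rate `P(Y_t = 0 | S_t(X_t) = 1, 𝓕_{t-1})`. -/
def IER [MeasurableSpace Ω] (P : Measure Ω) (α : ℝ) (γ : ℕ → ℝ) (q₁ : ℝ)
    (lfdrHat : ℕ → Ω → Feature d → ℝ) (D : Fin n → Ω → Example d)
    (X : ℕ → Ω → Feature d) (Y : ℕ → Ω → Fin 2) (t : ℕ) (ω : Ω) : ℝ :=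
  condProbGiven P {ω' | Y t ω' = 0} (selected α γ q₁ lfdrHat X Y t) (history D X Y (t - 1)) ω

/-- The incompressible failure probability
`δ = inf_{0 ≤ r < Bs} inf_{t ≥ 1} P(sup_{T ≥ t} q_T > r)` of a sequence `q` of random thresholds. -/
def failureProb [MeasurableSpace Ω] (P : Measure Ω) (q : ℕ → Ω → ℝ) (Bs : ℝ) : ℝ :=
  sInf {p : ℝ | ∃ r ∈ Set.Ico 0 Bs, ∃ t : ℕ, 1 ≤ t ∧
    p = P.real {ω | (r : EReal) < ⨆ (T : ℕ) (_ : t ≤ T), ((q T ω : ℝ) : EReal)}}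

/-- The estimation rate: there is `C₁ > 0` such that, for `t` large enough,
`P( E[|lfdrHat_t(X_t) - lfdr(X_t)| | 𝓕_{t-1}] ≥ C₁ (log t)^ν₀ t^(-ν) ) ≤ 3 / (π² t³)`. -/
def EstimationRate [MeasurableSpace Ω] (P : Measure Ω) (μ : Measure (Example d))
    [IsFiniteMeasure μ] (lfdrHat : ℕ → Ω → Feature d → ℝ) (D : Fin n → Ω → Example d)
    (X : ℕ → Ω → Feature d) (Y : ℕ → Ω → Fin 2) (ν₀ ν : ℝ) : Prop :=
  ∃ C₁ : ℝ, 0 < C₁ ∧ ∃ T₁ : ℕ, ∀ t : ℕ, T₁ ≤ t →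
    P.real {ω | C₁ * Real.log t ^ ν₀ * (t : ℝ) ^ (-ν) ≤
      (condExp (history D X Y (t - 1)) P
        fun ω' => |lfdrHat t ω' (X t ω') - lfdr μ (X t ω')|) ω} ≤ 3 / (Real.pi ^ 2 * (t : ℝ) ^ 3)

end Procedure

end OnlineTesting

end

/-! Write `a = 1 - α` and let `f` be the density of `W(X)`. With a perfect estimator, the mean
increment of a nonnegative threshold `q`, per unit of step, is `tailDrift`, that is `E[(a - W) 1{W >
q}]`. Its derivative in `q` is `-(a - q) f(q)`. On `[κ, Bs]` it therefore starts at `P(Y = 0) - α >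
0`, decreases up to `q = a`, where it is negative, and then increases to `0` at `Bs`. It has exactly
one zero `q₀` in `(κ, a)`, and it pulls towards `q₀` at a linear rate on every `[-c, r]` with `r <
Bs` (`exists_linear_drift`). It does not do so up to `Bs`: there nothing is selected any more and
the threshold freezes. This is the failure that `δ` measures. If `δ' > δ`, there are `r < Bs` and
`t₀` such that, outside an event of probability below `δ'`, all `q_T` with `T ≥ t₀` are at most `r`.

Outside that event four errors remain, controlled up to probability `O(1/t)`. Estimation: if the
estimator is within `ε²` of `lfdr` in mean, its selections differ from the oracle ones with
probability `O(ε)`, because `W(X)` has a bounded density (`real_selection_ne_le`). This halves the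
exponents of the rate. Step size: the conditional probability of selection stays at least some `p >
0`, so by Azuma–Hoeffding the number of selections grows linearly (`real_counter_lt_le`). The steps
in the second half of the time span are thus of exact order `t^(-β)`. Noise: over that half, the
martingale part of the recursion is `O(t^(-β) (t log t)^(1/2))`, by Azuma–Hoeffding and a union
bound. Initial condition: the linear drift contracts it by `exp(-C t^(1-β))`, which is `O(t^(β-1))`.

The deterministic lemma `abs_le_of_drift` combines the four, and `le_real_error_le` collects the
probabilities. Finally `IER_t - α` is the conditional drift divided by the conditional probability
of selection, so it inherits the bound on `|q_t - q₀|` and the estimation error. -/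

namespace OnlineTesting

/-! ### The oracle drift and its root -/

/-- The mean of `(a - w) 1{w > q}` under `ρ`. -/
noncomputable def tailDrift (ρ : Measure ℝ) (a q : ℝ) : ℝ := ∫ w in Set.Ioi q, (a - w) ∂ρ

/-- A probability law on `[κ, b]` with a continuous density that is positive on `(κ, b)`. -/
structure HasDensityOn (ρ : Measure ℝ) (f : ℝ → ℝ) (κ b : ℝ) : Prop where
  eq : ρ = volume.withDensity (fun w => ENNReal.ofReal (f w))
  cont : ContinuousOn f (Set.Icc κ b)
  pos : ∀ w ∈ Set.Ioo κ b, 0 < f w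
  zero : ∀ w ∉ Set.Icc κ b, f w = 0

namespace HasDensityOn

variable {ρ : Measure ℝ} {f : ℝ → ℝ} {κ b a : ℝ}

theorem exists_bound (h : HasDensityOn ρ f κ b) : ∃ K : ℝ, 0 < K ∧ ∀ w, f w ≤ K := by
  obtain ⟨K, hK⟩ := isCompact_Icc.exists_bound_of_continuousOn h.cont
  refine ⟨max K 1, by positivity, fun w => ?_⟩
  by_cases hw : w ∈ Set.Icc κ b
  · exact (le_abs_self _).trans ((hK w hw).trans (le_max_left _ _))
  · rw [h.zero w hw]; positivity

theorem real_le [IsFiniteMeasure ρ] (h : HasDensityOn ρ f κ b) {K : ℝ} (hK0 : 0 ≤ K)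
    (hK : ∀ w, f w ≤ K) {x y : ℝ} (hxy : x ≤ y) : ρ.real (Set.Icc x y) ≤ K * (y - x) := by
  refine ENNReal.toReal_le_of_le_ofReal (by nlinarith) ?_
  rw [h.eq, withDensity_apply _ measurableSet_Icc]
  calc ∫⁻ w in Set.Icc x y, ENNReal.ofReal (f w)
      ≤ ∫⁻ _ in Set.Icc x y, ENNReal.ofReal K :=
        lintegral_mono fun w => ENNReal.ofReal_le_ofReal (hK w)
    _ = ENNReal.ofReal (K * (y - x)) := by
        rw [setLIntegral_const, Real.volume_Icc, ENNReal.ofReal_mul hK0]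

theorem le_real [IsFiniteMeasure ρ] (h : HasDensityOn ρ f κ b) {m : ℝ} (hm : 0 ≤ m) {x y : ℝ}
    (hK : ∀ w ∈ Set.Ioc x y, m ≤ f w) : m * (y - x) ≤ ρ.real (Set.Ioc x y) := by
  refine (ENNReal.ofReal_le_iff_le_toReal (measure_ne_top _ _)).1 ?_
  rw [h.eq, withDensity_apply _ measurableSet_Ioc]
  calc ENNReal.ofReal (m * (y - x)) = ∫⁻ _ in Set.Ioc x y, ENNReal.ofReal m := by
        rw [setLIntegral_const, Real.volume_Ioc, ENNReal.ofReal_mul hm]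
    _ ≤ _ := setLIntegral_mono' measurableSet_Ioc
        fun w hw => ENNReal.ofReal_le_ofReal (hK w hw)

theorem exists_lower (h : HasDensityOn ρ f κ b) {x y : ℝ} (hx : κ < x) (hy : y < b) :
    ∃ m : ℝ, 0 < m ∧ ∀ w ∈ Set.Icc x y, m ≤ f w := by
  by_cases hxy : x ≤ y
  · obtain ⟨z, hz, hmin⟩ := isCompact_Icc.exists_isMinOn (Set.nonempty_Icc.2 hxy)
      (h.cont.mono (Set.Icc_subset_Icc hx.le hy.le))
    exact ⟨f z, h.pos z ⟨hx.trans_le hz.1, hz.2.trans_lt hy⟩, fun w hw => hmin hw⟩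
  · exact ⟨1, one_pos, fun w hw => (hxy (hw.1.trans hw.2)).elim⟩

theorem real_Ioc_pos [IsFiniteMeasure ρ] (h : HasDensityOn ρ f κ b) {x y : ℝ} (hx : κ ≤ x) (hxy : x < y)
    (hy : y ≤ b) : 0 < ρ.real (Set.Ioc x y) := by
  obtain ⟨m, hm, hmf⟩ := h.exists_lower (x := (2 * x + y) / 3) (y := (x + 2 * y) / 3)
    (by linarith) (by linarith)
  have h1 := h.le_real hm.le (fun w hw => hmf w (Set.Ioc_subset_Icc_self hw))
  have h2 : ρ.real (Set.Ioc ((2 * x + y) / 3) ((x + 2 * y) / 3)) ≤ ρ.real (Set.Ioc x y) :=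
    measureReal_mono (Set.Ioc_subset_Ioc (by linarith) (by linarith))
  have : 0 < m * ((x + 2 * y) / 3 - (2 * x + y) / 3) := mul_pos hm (by linarith)
  linarith

theorem ae_mem (h : HasDensityOn ρ f κ b) : ∀ᵐ w ∂ρ, w ∈ Set.Icc κ b := by
  rw [ae_iff, h.eq]
  change (volume.withDensity _) (Set.Icc κ b)ᶜ = 0
  rw [withDensity_apply _ measurableSet_Icc.compl,
    setLIntegral_congr_fun (g := fun _ => 0) measurableSet_Icc.compl
      (fun w hw => by simp [h.zero w hw])]
  simp

theorem integrable [IsFiniteMeasure ρ] (h : HasDensityOn ρ f κ b) (a : ℝ) :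
    Integrable (fun w => a - w) ρ := by
  refine (integrable_const a).sub (Integrable.of_mem_Icc κ b ?_ h.ae_mem)
  fun_prop

theorem tailDrift_sub [IsFiniteMeasure ρ] (h : HasDensityOn ρ f κ b) {x y : ℝ} (hxy : x ≤ y) :
    tailDrift ρ a x - tailDrift ρ a y = ∫ w in Set.Ioc x y, (a - w) ∂ρ := by
  unfold tailDrift
  rw [← Set.Ioc_union_Ioi_eq_Ioi hxy, setIntegral_union _ measurableSet_Ioi
    (h.integrable a).integrableOn (h.integrable a).integrableOn]
  · ring
  · exact Set.disjoint_left.2 fun w hw hw' => absurd hw.2 (not_le.2 hw')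

theorem abs_tailDrift_sub_le [IsFiniteMeasure ρ] (h : HasDensityOn ρ f κ b) {K : ℝ} (hK0 : 0 ≤ K)
    (hK : ∀ w, f w ≤ K) (hκ : 0 ≤ κ) (hb : b ≤ 1) (ha : a ∈ Set.Icc (0 : ℝ) 1) (x y : ℝ) :
    |tailDrift ρ a x - tailDrift ρ a y| ≤ K * |x - y| := by
  wlog hxy : x ≤ y generalizing x y
  · rw [abs_sub_comm, abs_sub_comm x]; exact this y x (le_of_not_ge hxy)
  rw [h.tailDrift_sub hxy, abs_sub_comm x, abs_of_nonneg (sub_nonneg.2 hxy)]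
  have h1 : ‖∫ w in Set.Ioc x y, (a - w) ∂ρ‖ ≤ 1 * ρ.real (Set.Ioc x y) := by
    refine norm_setIntegral_le_of_norm_le_const_ae (measure_lt_top _ _) ?_
    filter_upwards [ae_restrict_of_ae h.ae_mem] with w hw
    rw [Real.norm_eq_abs, abs_le]
    constructor <;> linarith [hw.1, hw.2, ha.1, ha.2]
  rw [Real.norm_eq_abs, one_mul] at h1
  exact h1.trans ((measureReal_mono Set.Ioc_subset_Icc_self).trans (h.real_le hK0 hK hxy))

theorem mul_le_tailDrift_sub [IsFiniteMeasure ρ] (h : HasDensityOn ρ f κ b) {x y : ℝ} (hxy : x ≤ y) :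
    (a - y) * ρ.real (Set.Ioc x y) ≤ tailDrift ρ a x - tailDrift ρ a y := by
  rw [h.tailDrift_sub hxy]
  calc (a - y) * ρ.real (Set.Ioc x y) = ∫ _ in Set.Ioc x y, (a - y) ∂ρ := by
        rw [setIntegral_const, smul_eq_mul, mul_comm]
    _ ≤ _ := setIntegral_mono_on (integrable_const _).integrableOn (h.integrable a).integrableOn
        measurableSet_Ioc fun w hw => by linarith [hw.2]

/-- The integrand `a - w` changes sign at `w = a`, which makes `a` the turning point of the drift.
-/
theorem tailDrift_antitone [IsFiniteMeasure ρ] (h : HasDensityOn ρ f κ b) {x y : ℝ} (hxy : x ≤ y)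
    (hy : y ≤ a) : tailDrift ρ a y ≤ tailDrift ρ a x := by
  have := h.mul_le_tailDrift_sub (a := a) hxy
  have h2 : 0 ≤ (a - y) * ρ.real (Set.Ioc x y) := mul_nonneg (by linarith) measureReal_nonneg
  linarith

theorem tailDrift_mono [IsFiniteMeasure ρ] (h : HasDensityOn ρ f κ b) {x y : ℝ} (hxy : x ≤ y)
    (hx : a ≤ x) : tailDrift ρ a x ≤ tailDrift ρ a y := by
  have h1 : ∫ w in Set.Ioc x y, (a - w) ∂ρ ≤ 0 :=
    setIntegral_nonpos measurableSet_Ioc fun w hw => by linarith [hw.1]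
  rw [← h.tailDrift_sub hxy] at h1
  linarith

theorem tailDrift_eq_zero (h : HasDensityOn ρ f κ b) : tailDrift ρ a b = 0 := by
  unfold tailDrift
  rw [setIntegral_measure_zero]
  refine measure_mono_null (fun w hw => ?_) (ae_iff.1 h.ae_mem)
  exact fun hw' => absurd hw'.2 (not_le.2 hw)

/-- The drift increases to its value `0` at `b`, strictly so on the upper half of `[x, b]`: that
half has positive mass, and `a - w` is bounded away from `0` there even when `x = a`. -/
theorem tailDrift_neg [IsFiniteMeasure ρ] (h : HasDensityOn ρ f κ b) {x : ℝ} (hκ : κ ≤ a) (hx : a ≤ x)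
    (hxb : x < b) : tailDrift ρ a x < 0 := by
  set y := (x + b) / 2 with hy
  have hxy : x < y := by rw [hy]; linarith
  have hyb : y < b := by rw [hy]; linarith
  have h3 := h.real_Ioc_pos (hκ.trans (hx.trans hxy.le)) hyb le_rfl
  have h2 : ∫ w in Set.Ioc y b, (a - w) ∂ρ ≤ ∫ _ in Set.Ioc y b, (a - y) ∂ρ :=
    setIntegral_mono_on (h.integrable a).integrableOn (integrable_const _).integrableOn
      measurableSet_Ioc fun w hw => by linarith [hw.1]
  rw [setIntegral_const, smul_eq_mul, ← h.tailDrift_sub hyb.le, h.tailDrift_eq_zero] at h2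
  have h4 := h.tailDrift_mono hxy.le hx
  nlinarith

theorem tailDrift_strictAnti [IsFiniteMeasure ρ] (h : HasDensityOn ρ f κ b) {x y : ℝ} (hκ : κ ≤ x)
    (hxy : x < y) (hy : y ≤ a) (hyb : y ≤ b) : tailDrift ρ a y < tailDrift ρ a x := by
  -- The factor `a - y` may vanish, since `y = a` is allowed; the strict decrease is gained on the
  -- first half, where `a - z > 0`.
  set z := (x + y) / 2 with hz
  have hxz : x < z := by rw [hz]; linarith
  have hzy : z < y := by rw [hz]; linarith
  have h1 := h.mul_le_tailDrift_sub (a := a) hxz.le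
  have h2 := h.real_Ioc_pos hκ hxz (hzy.le.trans hyb)
  have h3 := h.tailDrift_antitone hzy.le hy
  have : 0 < (a - z) * ρ.real (Set.Ioc x z) := mul_pos (by linarith) h2
  linarith

theorem exists_root [IsFiniteMeasure ρ] (h : HasDensityOn ρ f κ b) (hκ0 : 0 ≤ κ) (hb : b ≤ 1)
    (ha : a ∈ Set.Icc (0 : ℝ) 1) (hκ : κ < a) (hab : a < b) (hpos : 0 < tailDrift ρ a κ) :
    ∃ q₀ ∈ Set.Ioo κ a, tailDrift ρ a q₀ = 0 := by
  obtain ⟨K, hK0, hK⟩ := h.exists_bound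
  have hcont : Continuous (tailDrift ρ a) := by
    refine (LipschitzWith.of_dist_le_mul (K := ⟨K, hK0.le⟩) fun x y => ?_).continuous
    rw [Real.dist_eq, Real.dist_eq]
    exact h.abs_tailDrift_sub_le hK0.le hK hκ0 hb ha x y
  exact intermediate_value_Ioo' hκ.le hcont.continuousOn
    ⟨h.tailDrift_neg hκ.le le_rfl hab, hpos⟩

/-- Linear drift towards the root, up to any level below the right end of the support. -/
theorem exists_linear_drift [IsFiniteMeasure ρ] (h : HasDensityOn ρ f κ b) {q₀ : ℝ}
    (hq₀ : q₀ ∈ Set.Ioo κ a) (hab : a < b) (hroot : tailDrift ρ a q₀ = 0) {r : ℝ} (hr : r < b)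
    (M : ℝ) : ∃ A : ℝ, 0 < A ∧
      (∀ q ∈ Set.Icc (-M) q₀, A * (q₀ - q) ≤ tailDrift ρ a q) ∧
      ∀ q ∈ Set.Icc q₀ r, tailDrift ρ a q ≤ -(A * (q - q₀)) := by
  obtain ⟨η, hη, h1, h2⟩ : ∃ η : ℝ, 0 < η ∧ κ < q₀ - η ∧ q₀ + η < a := by
    refine ⟨min (q₀ - κ) (a - q₀) / 2, ?_, ?_, ?_⟩
    · have := lt_min (sub_pos.2 hq₀.1) (sub_pos.2 hq₀.2); linarith
    · linarith [min_le_left (q₀ - κ) (a - q₀), lt_min (sub_pos.2 hq₀.1) (sub_pos.2 hq₀.2), hq₀.1]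
    · linarith [min_le_right (q₀ - κ) (a - q₀), lt_min (sub_pos.2 hq₀.1) (sub_pos.2 hq₀.2), hq₀.2]
  obtain ⟨m, hm, hmf⟩ := h.exists_lower (x := q₀ - η) (y := q₀ + η) h1 (h2.trans hab)
  -- Right of `a` the drift increases, so on `[a, r]` it is largest at the right end; `R ≥ a` and `R
  -- < b` make its value there negative.
  set R := max r a with hR
  have hRb : R < b := max_lt hr hab
  have hneg : 0 < min (-tailDrift ρ a (q₀ + η)) (-tailDrift ρ a R) := by
    refine lt_min (neg_pos.2 ?_) (neg_pos.2 (h.tailDrift_neg (hq₀.1.trans hq₀.2).le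
      (le_max_right _ _) hRb))
    rw [← hroot]
    exact h.tailDrift_strictAnti hq₀.1.le (by linarith) h2.le (by linarith)
  have hpos : 0 < tailDrift ρ a (q₀ - η) := by
    rw [← hroot]
    exact h.tailDrift_strictAnti h1.le (by linarith) hq₀.2.le (by linarith [hq₀.2])
  set N := |q₀| + |M| + |r| + 1 with hN
  have hN0 : 0 < N := by positivity
  -- Within `η` of the root, the slope is at least `(a - (q₀ + η)) * m`. Farther away, by
  -- monotonicity on each side of `a`, the absolute drift is at least one of its values at `q₀ - η`,
  -- `q₀ + η` and `R`, while `N` bounds the distance to `q₀`.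
  set A := min ((a - (q₀ + η)) * m)
    (min (tailDrift ρ a (q₀ - η)) (min (-tailDrift ρ a (q₀ + η)) (-tailDrift ρ a R)) / N) with hA
  have hA0 : 0 < A := lt_min (mul_pos (by linarith) hm) (div_pos (lt_min hpos hneg) hN0)
  have hA1 : A ≤ (a - (q₀ + η)) * m := min_le_left _ _
  have hA2 : A * N ≤ min (tailDrift ρ a (q₀ - η))
      (min (-tailDrift ρ a (q₀ + η)) (-tailDrift ρ a R)) :=
    (le_div_iff₀ hN0).1 (min_le_right _ _)
  refine ⟨A, hA0, fun q hq => ?_, fun q hq => ?_⟩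
  · rcases le_total (q₀ - η) q with hq' | hq'
    · have h3 := h.mul_le_tailDrift_sub (a := a) hq.2
      have h4 := h.le_real hm.le (x := q) (y := q₀)
        fun w hw => hmf w ⟨hq'.trans hw.1.le, by linarith [hw.2]⟩
      rw [hroot, sub_zero] at h3
      have h5 : (a - q₀) * (m * (q₀ - q)) ≤ (a - q₀) * ρ.real (Set.Ioc q q₀) :=
        mul_le_mul_of_nonneg_left h4 (by linarith [hq₀.2])
      have h6 : A * (q₀ - q) ≤ (a - (q₀ + η)) * m * (q₀ - q) :=
        mul_le_mul_of_nonneg_right hA1 (by linarith [hq.2])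
      have h7 : 0 ≤ η * (m * (q₀ - q)) :=
        mul_nonneg hη.le (mul_nonneg hm.le (by linarith [hq.2]))
      nlinarith
    · have h3 := h.tailDrift_antitone (a := a) hq' (by linarith)
      have h4 : A * (q₀ - q) ≤ A * N := by
        refine mul_le_mul_of_nonneg_left ?_ hA0.le
        linarith [hq.1, le_abs_self q₀, le_abs_self M, abs_nonneg r]
      exact h4.trans (hA2.trans ((min_le_left _ _).trans h3))
  · rcases le_total q (q₀ + η) with hq' | hq'
    · have h3 := h.mul_le_tailDrift_sub (a := a) hq.1
      have h4 := h.le_real hm.le (x := q₀) (y := q)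
        fun w hw => hmf w ⟨by linarith [hw.1], by linarith [hw.2]⟩
      rw [hroot, zero_sub] at h3
      have h5 : (a - q) * (m * (q - q₀)) ≤ (a - q) * ρ.real (Set.Ioc q₀ q) :=
        mul_le_mul_of_nonneg_left h4 (by linarith)
      have h6 : A * (q - q₀) ≤ (a - (q₀ + η)) * m * (q - q₀) :=
        mul_le_mul_of_nonneg_right hA1 (by linarith [hq.1])
      have h7 : 0 ≤ (q₀ + η - q) * (m * (q - q₀)) :=
        mul_nonneg (by linarith) (mul_nonneg hm.le (by linarith [hq.1]))
      nlinarith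
    · have h4 : A * (q - q₀) ≤ A * N := by
        refine mul_le_mul_of_nonneg_left ?_ hA0.le
        linarith [hq.2, neg_abs_le q₀, le_abs_self r, abs_nonneg M]
      have h5 := h4.trans (hA2.trans (min_le_right _ _))
      rcases le_total q a with hqa | hqa
      · have h3 := h.tailDrift_antitone (a := a) hq' hqa
        linarith [min_le_left (-tailDrift ρ a (q₀ + η)) (-tailDrift ρ a R)]
      · have h3 := h.tailDrift_mono (a := a) (hq.2.trans (le_max_left r a)) hqa
        linarith [min_le_right (-tailDrift ρ a (q₀ + η)) (-tailDrift ρ a R)]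

end HasDensityOn

/-! ### Independence of the next example from the past -/

theorem generateFrom_image2_inter {Ω : Type*} (m₁ m₂ : MeasurableSpace Ω) :
    m₁ ⊔ m₂ = MeasurableSpace.generateFrom
      (Set.image2 (· ∩ ·) {s | MeasurableSet[m₁] s} {s | MeasurableSet[m₂] s}) := by
  refine le_antisymm (sup_le (fun s hs => ?_) fun s hs => ?_)
    (MeasurableSpace.generateFrom_le ?_)
  · exact MeasurableSpace.measurableSet_generateFrom
      ⟨s, hs, Set.univ, @MeasurableSet.univ _ m₂, Set.inter_univ s⟩
  · exact MeasurableSpace.measurableSet_generateFrom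
      ⟨Set.univ, @MeasurableSet.univ _ m₁, s, hs, Set.univ_inter s⟩
  · rintro _ ⟨s, hs, u, hu, rfl⟩
    exact MeasurableSet.inter ((le_sup_left : m₁ ≤ m₁ ⊔ m₂) s hs)
      ((le_sup_right : m₂ ≤ m₁ ⊔ m₂) u hu)

/-- Intersections form a π-system generating the join, and on it the product formula follows by
factoring twice. It is applied with `m₁` the holdout sample, `m₂` the past stream and `m₃` the next
example. -/
theorem indep_sup_left {Ω : Type*} {mΩ : MeasurableSpace Ω} {P : Measure Ω}
    [IsProbabilityMeasure P] {m₁ m₂ m₃ : MeasurableSpace Ω} (h₁ : m₁ ≤ mΩ) (h₂ : m₂ ≤ mΩ)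
    (h₃ : m₃ ≤ mΩ) (h : Indep m₁ (m₂ ⊔ m₃) P) (h' : Indep m₂ m₃ P) : Indep (m₁ ⊔ m₂) m₃ P := by
  refine IndepSets.indep (sup_le h₁ h₂) h₃ (p2 := {s | MeasurableSet[m₃] s}) ?_
    (@MeasurableSpace.isPiSystem_measurableSet _ m₃) (generateFrom_image2_inter m₁ m₂)
    (@MeasurableSpace.generateFrom_measurableSet _ m₃).symm ?_
  · rintro _ ⟨s, hs, u, hu, rfl⟩ _ ⟨s', hs', u', hu', rfl⟩ -
    exact ⟨s ∩ s', MeasurableSet.inter hs hs', u ∩ u', MeasurableSet.inter hu hu',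
      Set.inter_inter_inter_comm _ _ _ _⟩
  · rw [IndepSets_iff]
    rintro _ v ⟨s, hs, u, hu, rfl⟩ hv
    rw [Indep_iff] at h h'
    have e1 := h s (u ∩ v) hs (MeasurableSet.inter ((le_sup_left : m₂ ≤ m₂ ⊔ m₃) u hu)
      ((le_sup_right : m₃ ≤ m₂ ⊔ m₃) v hv))
    have e2 := h s u hs ((le_sup_left : m₂ ≤ m₂ ⊔ m₃) u hu)
    rw [Set.inter_assoc, e1, e2, h' u v hu hv, mul_assoc]

section History

variable {Ω : Type*} {d n : ℕ}

theorem history_mono (D : Fin n → Ω → Example d) (X : ℕ → Ω → Feature d) (Y : ℕ → Ω → Fin 2) :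
    Monotone (history D X Y) := fun _ _ h =>
  sup_le_sup_left (biSup_mono fun _ hk => ⟨hk.1, hk.2.trans h⟩) _

theorem history_le [mΩ : MeasurableSpace Ω] {D : Fin n → Ω → Example d} {X : ℕ → Ω → Feature d}
    {Y : ℕ → Ω → Fin 2} (hD : ∀ i, Measurable (D i)) (hX : ∀ t, Measurable (X t))
    (hY : ∀ t, Measurable (Y t)) (t : ℕ) : history D X Y t ≤ mΩ :=
  sup_le (iSup_le fun i => (hD i).comap_le)
    (iSup₂_le fun k _ => ((hX k).prodMk (hY k)).comap_le)

theorem measurable_history_pair (D : Fin n → Ω → Example d) (X : ℕ → Ω → Feature d)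
    (Y : ℕ → Ω → Fin 2) {k t : ℕ} (hk : 1 ≤ k) (hkt : k ≤ t) :
    Measurable[history D X Y t] (fun ω => (X k ω, Y k ω)) := by
  refine (comap_measurable (fun ω => (X k ω, Y k ω))).mono ?_ le_rfl
  exact (le_iSup₂_of_le (f := fun k (_ : k ∈ Set.Icc 1 t) =>
    MeasurableSpace.comap (fun ω => (X k ω, Y k ω)) inferInstance) k ⟨hk, hkt⟩ le_rfl).trans
    le_sup_right

theorem indep_history [mΩ : MeasurableSpace Ω] {P : Measure Ω} [IsProbabilityMeasure P]
    {D : Fin n → Ω → Example d} {X : ℕ → Ω → Feature d} {Y : ℕ → Ω → Fin 2}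
    (hD : ∀ i, Measurable (D i)) (hX : ∀ t, Measurable (X t)) (hY : ∀ t, Measurable (Y t))
    (hindep : iIndepFun (fun (k : ℕ) (ω : Ω) => (X (k + 1) ω, Y (k + 1) ω)) P)
    (hholdout : IndepFun (fun ω i => D i ω) (fun ω (k : ℕ) => (X (k + 1) ω, Y (k + 1) ω)) P)
    (t : ℕ) :
    Indep (history D X Y t)
      (MeasurableSpace.comap (fun ω => (X (t + 1) ω, Y (t + 1) ω)) inferInstance) P := by
  have hZ : ∀ k, Measurable fun ω => (X k ω, Y k ω) := fun k => (hX k).prodMk (hY k)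
  have hseq : ∀ k, MeasurableSpace.comap (fun ω => (X (k + 1) ω, Y (k + 1) ω)) inferInstance ≤
      MeasurableSpace.comap (fun ω (k : ℕ) => (X (k + 1) ω, Y (k + 1) ω)) inferInstance := by
    intro k
    have h1 : Measurable[MeasurableSpace.comap
        (fun ω (k : ℕ) => (X (k + 1) ω, Y (k + 1) ω)) inferInstance]
        (fun ω => (X (k + 1) ω, Y (k + 1) ω)) :=
      (measurable_pi_apply k).comp (comap_measurable fun ω (k : ℕ) => (X (k + 1) ω, Y (k + 1) ω))
    exact h1.comap_le
  refine indep_sup_left (iSup_le fun i => (hD i).comap_le) (iSup₂_le fun k _ => (hZ k).comap_le)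
    (hZ _).comap_le ?_ ?_
  · refine indep_of_indep_of_le_left (indep_of_indep_of_le_right hholdout ?_) ?_
    · refine sup_le (iSup₂_le fun k hk => ?_) (hseq t)
      obtain ⟨j, rfl⟩ : ∃ j, k = j + 1 := ⟨k - 1, by have := hk.1; omega⟩
      exact hseq j
    · refine iSup_le fun i => ?_
      have h1 : Measurable[MeasurableSpace.comap (fun ω i => D i ω) inferInstance] (D i) :=
        (measurable_pi_apply i).comp (comap_measurable fun ω i => D i ω)
      exact h1.comap_le
  · have h1 := indep_iSup_of_disjoint (S := {k | k + 1 ≤ t}) (T := {t})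
      (fun k => (hZ (k + 1)).comap_le) hindep.iIndep
      (Set.disjoint_singleton_right.2 fun h => by simp at h)
    refine indep_of_indep_of_le_left (indep_of_indep_of_le_right h1 ?_) ?_
    · exact le_iSup₂_of_le (f := fun k (_ : k ∈ ({t} : Set ℕ)) => MeasurableSpace.comap
        (fun ω => (X (k + 1) ω, Y (k + 1) ω)) inferInstance) t rfl le_rfl
    · refine iSup₂_le fun k hk => ?_
      obtain ⟨j, rfl⟩ : ∃ j, k = j + 1 := ⟨k - 1, by have := hk.1; omega⟩
      exact le_iSup₂_of_le (f := fun k (_ : k ∈ {k | k + 1 ≤ t}) => MeasurableSpace.comap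
        (fun ω => (X (k + 1) ω, Y (k + 1) ω)) inferInstance) j hk.2 le_rfl

end History

/-! ### Freezing the past: conditional expectations as integrals over the next example -/

section Independence

variable {Ω Ω' E : Type*} [mΩ : MeasurableSpace Ω] [mΩ' : MeasurableSpace Ω']
  [mE : MeasurableSpace E]
  {P : Measure Ω} [IsProbabilityMeasure P] {T : Ω → Ω'} {Z : Ω → E} {μ : Measure E}
  [IsProbabilityMeasure μ]

theorem measurable_integral_section {φ : Ω' × E → ℝ} (hφ : Measurable φ) :
    Measurable fun ω => ∫ z, φ (ω, z) ∂μ :=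
  (StronglyMeasurable.integral_prod_right (f := fun ω z => φ (ω, z)) (ν := μ)
    hφ.stronglyMeasurable).measurable

theorem abs_integral_le_of_abs_le {g : E → ℝ} {C : ℝ} (hb : ∀ z, |g z| ≤ C) :
    |∫ z, g z ∂μ| ≤ C := by
  have h1 : ‖∫ z, g z ∂μ‖ ≤ C * μ.real Set.univ :=
    norm_integral_le_of_norm_le_const (Filter.Eventually.of_forall hb)
  simpa using h1

theorem integral_comp_of_indepFun (hT : Measurable T) (hZ : Measurable Z) (hTZ : IndepFun T Z P)
    (hμ : P.map Z = μ) {φ : Ω' × E → ℝ} (hφ : Measurable φ) {C : ℝ} (hb : ∀ p, |φ p| ≤ C) :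
    ∫ ω, φ (T ω, Z ω) ∂P = ∫ ω, ∫ z, φ (T ω, z) ∂μ ∂P := by
  have h1 := (indepFun_iff_map_prod_eq_prod_map_map hT.aemeasurable hZ.aemeasurable).1 hTZ
  rw [hμ] at h1
  have : IsProbabilityMeasure (P.map T) := Measure.isProbabilityMeasure_map hT.aemeasurable
  calc ∫ ω, φ (T ω, Z ω) ∂P = ∫ p, φ p ∂(P.map fun ω => (T ω, Z ω)) :=
        (integral_map (hT.prodMk hZ).aemeasurable hφ.aestronglyMeasurable).symm
    _ = ∫ x, ∫ z, φ (x, z) ∂μ ∂(P.map T) := by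
        rw [h1, integral_prod]
        exact Integrable.of_bound hφ.aestronglyMeasurable C (Filter.Eventually.of_forall hb)
    _ = _ := integral_map hT.aemeasurable
        (measurable_integral_section hφ).aestronglyMeasurable

/-- By Fubini under the product law, integrating out `Z` first annihilates the centred factor. This
is the source of all martingale differences below. -/
theorem integral_mul_centered (hT : Measurable T) (hZ : Measurable Z) (hTZ : IndepFun T Z P)
    (hμ : P.map Z = μ) {φ : Ω' × E → ℝ} (hφ : Measurable φ) {C : ℝ} (hb : ∀ p, |φ p| ≤ C)
    {G : Ω' → ℝ} (hG : Measurable G) {C' : ℝ} (hG' : ∀ x, |G x| ≤ C') :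
    ∫ ω, G (T ω) * (φ (T ω, Z ω) - ∫ z, φ (T ω, z) ∂μ) ∂P = 0 := by
  have hb' : ∀ p : Ω' × E, |G p.1 * φ p| ≤ C' * C := fun p => by
    rw [abs_mul]
    exact mul_le_mul (hG' _) (hb _) (abs_nonneg _) ((abs_nonneg _).trans (hG' p.1))
  have hm : Measurable fun p : Ω' × E => G p.1 * φ p := (hG.comp measurable_fst).mul hφ
  have h1 := integral_comp_of_indepFun hT hZ hTZ hμ hm hb'
  simp only [integral_const_mul] at h1
  simp only [mul_sub]
  rw [integral_sub, h1, sub_self]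
  · exact Integrable.of_bound (hm.comp (hT.prodMk hZ)).aestronglyMeasurable (C' * C)
      (Filter.Eventually.of_forall fun ω => hb' (T ω, Z ω))
  · refine Integrable.of_bound ((hG.comp hT).mul
      ((measurable_integral_section hφ).comp hT)).aestronglyMeasurable (C' * C)
      (Filter.Eventually.of_forall fun ω => ?_)
    rw [Real.norm_eq_abs, abs_mul]
    exact mul_le_mul (hG' _) (abs_integral_le_of_abs_le fun z => hb _) (abs_nonneg _)
      ((abs_nonneg _).trans (hG' (T ω)))

end Independence

section CondExp

variable {Ω E : Type*} {m : MeasurableSpace Ω} [mΩ : MeasurableSpace Ω] [mE : MeasurableSpace E]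
  {P : Measure Ω} [IsProbabilityMeasure P] {Z : Ω → E} {μ : Measure E}
  [IsProbabilityMeasure μ]

theorem integral_mul_centered_of_indep (hm : m ≤ mΩ) (hZ : Measurable[mΩ] Z)
    (hmZ : Indep m (MeasurableSpace.comap Z mE) P)
    (hμ : P.map Z = μ) {φ : Ω × E → ℝ} (hφ : Measurable[m.prod mE] φ) {C : ℝ}
    (hb : ∀ p, |φ p| ≤ C) {G : Ω → ℝ} (hG : Measurable[m] G) {C' : ℝ} (hG' : ∀ x, |G x| ≤ C') :
    ∫ ω, G ω * (φ (ω, Z ω) - ∫ z, φ (ω, z) ∂μ) ∂P = 0 := by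
  have h1 : @IndepFun Ω Ω E mΩ m mE id Z P := by
    change Indep (MeasurableSpace.comap id m) _ P
    rwa [MeasurableSpace.comap_id]
  -- The past is encoded as the identity map from `Ω` with `mΩ` to `Ω` with the coarser `m`; hence
  -- the explicit `σ`-fields.
  exact @integral_mul_centered Ω Ω E mΩ m mE P _ id Z μ _ (measurable_id'' hm) hZ h1 hμ φ hφ C hb
    G hG C' hG'

theorem condExp_ae_eq_integral_section (hm : m ≤ mΩ) (hZ : Measurable[mΩ] Z)
    (hmZ : Indep m (MeasurableSpace.comap Z mE) P)
    (hμ : P.map Z = μ) {φ : Ω × E → ℝ} (hφ : Measurable[m.prod mE] φ) {C : ℝ}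
    (hb : ∀ p, |φ p| ≤ C) :
    condExp m P (fun ω => φ (ω, Z ω)) =ᵐ[P] fun ω => ∫ z, φ (ω, z) ∂μ := by
  have hmeas : Measurable[m] fun ω => ∫ z, φ (ω, z) ∂μ :=
    @measurable_integral_section Ω E m mE μ _ φ hφ
  have hpair : Measurable[mΩ, m.prod mE] fun ω => (ω, Z ω) :=
    (measurable_id'' hm).prodMk hZ
  have hint : Integrable (fun ω => φ (ω, Z ω)) P :=
    Integrable.of_bound (hφ.comp hpair).aestronglyMeasurable C
      (Filter.Eventually.of_forall fun ω => hb _)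
  have hint' : Integrable (fun ω => ∫ z, φ (ω, z) ∂μ) P :=
    Integrable.of_bound (hmeas.mono hm le_rfl).aestronglyMeasurable C
      (Filter.Eventually.of_forall fun ω => abs_integral_le_of_abs_le fun z => hb _)
  refine (ae_eq_condExp_of_forall_setIntegral_eq hm hint (fun _ _ _ => hint'.integrableOn)
    (fun s hs _ => ?_) (hmeas.stronglyMeasurable).aestronglyMeasurable).symm
  have h1 := integral_mul_centered_of_indep hm hZ hmZ hμ hφ hb
    (G := s.indicator fun _ => (1 : ℝ)) (measurable_const.indicator hs) (C' := 1)
    (fun x => by by_cases hx : x ∈ s <;> simp [hx])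
  rw [← integral_indicator (hm s hs), ← integral_indicator (hm s hs), eq_comm, ← sub_eq_zero,
    ← integral_sub (hint.indicator (hm s hs)) (hint'.indicator (hm s hs)), ← h1]
  congr 1
  ext ω
  by_cases hω : ω ∈ s <;> simp [hω]

end CondExp

/-! ### Azuma–Hoeffding for bounded martingale increments -/

/-- The right side is the chord of the convex function `x ↦ exp (θ x)` over `[-b, b]`. Being affine
in `x`, it leaves only the `cosh` term after integration against an orthogonal increment. -/
theorem exp_mul_le_cosh_add_sinh {b x : ℝ} (hb : 0 < b) (hx : |x| ≤ b) (θ : ℝ) :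
    Real.exp (θ * x) ≤ Real.cosh (θ * b) + x * (Real.sinh (θ * b) / b) := by
  obtain ⟨h1, h2⟩ := abs_le.1 hx
  obtain ⟨-, hconv⟩ := convexOn_exp
  have h := hconv (Set.mem_univ (θ * b)) (Set.mem_univ (-(θ * b)))
    (show 0 ≤ (b + x) / (2 * b) from div_nonneg (by linarith) (by linarith))
    (show 0 ≤ (b - x) / (2 * b) from div_nonneg (by linarith) (by linarith))
    (by field_simp; ring)
  simp only [smul_eq_mul] at h
  have e1 : (b + x) / (2 * b) * (θ * b) + (b - x) / (2 * b) * -(θ * b) = θ * x := by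
    field_simp; ring
  rw [e1] at h
  refine h.trans (le_of_eq ?_)
  rw [Real.cosh_eq, Real.sinh_eq]
  field_simp; ring

/-- Bounded martingale increments: `D i` is adapted, bounded by `b` and orthogonal to the bounded
functions that are measurable for the past. -/
structure BoundedIncrements {Ω : Type*} [MeasurableSpace Ω] (P : Measure Ω)
    (F : ℕ → MeasurableSpace Ω) (D : ℕ → Ω → ℝ) (b : ℝ) : Prop where
  adapted : ∀ i, Measurable[F (i + 1)] (D i)
  bound : ∀ i ω, |D i ω| ≤ b
  orthogonal : ∀ i (G : Ω → ℝ) (C : ℝ), Measurable[F i] G → (∀ ω, |G ω| ≤ C) →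
    ∫ ω, G ω * D i ω ∂P = 0

namespace BoundedIncrements

variable {Ω : Type*} [mΩ : MeasurableSpace Ω] {P : Measure Ω}
  {F : ℕ → MeasurableSpace Ω} {D : ℕ → Ω → ℝ} {b : ℝ}

theorem neg (h : BoundedIncrements P F D b) : BoundedIncrements P F (fun i ω => -D i ω) b where
  adapted i := (h.adapted i).neg
  bound i ω := by rw [abs_neg]; exact h.bound i ω
  orthogonal i G C hG hC := by
    simp only [mul_neg, integral_neg, h.orthogonal i G C hG hC, neg_zero]

theorem measurable_sum (h : BoundedIncrements P F D b) (hF : Monotone F) (k : ℕ) :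
    Measurable[F k] fun ω => ∑ i ∈ Finset.range k, D i ω :=
  Finset.measurable_fun_sum _ fun i hi =>
    (h.adapted i).mono (hF (Finset.mem_range.1 hi)) le_rfl

theorem abs_sum_le (h : BoundedIncrements P F D b) (k : ℕ) (ω : Ω) :
    |∑ i ∈ Finset.range k, D i ω| ≤ k * b := by
  refine (Finset.abs_sum_le_sum_abs _ _).trans ?_
  simpa using Finset.sum_le_card_nsmul (Finset.range k) _ b fun i _ => h.bound i ω

theorem integral_exp_le [IsProbabilityMeasure P] (h : BoundedIncrements P F D b) (hb : 0 < b)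
    (hF : Monotone F)
    (hle : ∀ i, F i ≤ mΩ) (θ : ℝ) (k : ℕ) :
    ∫ ω, Real.exp (θ * ∑ i ∈ Finset.range k, D i ω) ∂P ≤ Real.exp (k * ((θ * b) ^ 2 / 2)) := by
  have hmeas : ∀ k, Measurable[F k] fun ω => Real.exp (θ * ∑ i ∈ Finset.range k, D i ω) :=
    fun k => Real.measurable_exp.comp ((h.measurable_sum hF k).const_mul θ)
  have hbd : ∀ k ω, |Real.exp (θ * ∑ i ∈ Finset.range k, D i ω)| ≤ Real.exp (|θ| * (k * b)) := by
    intro k ω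
    rw [abs_of_pos (Real.exp_pos _), Real.exp_le_exp]
    refine (le_abs_self _).trans ?_
    rw [abs_mul]
    exact mul_le_mul_of_nonneg_left (h.abs_sum_le k ω) (abs_nonneg _)
  have hint : ∀ k, Integrable (fun ω => Real.exp (θ * ∑ i ∈ Finset.range k, D i ω)) P := fun k =>
    Integrable.of_bound ((hmeas k).mono (hle k) le_rfl).aestronglyMeasurable _
      (Filter.Eventually.of_forall (hbd k))
  induction k with
  | zero => simp
  | succ k ih =>
    have hint2 : Integrable (fun ω => Real.exp (θ * ∑ i ∈ Finset.range k, D i ω) * D k ω) P :=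
      (hint k).mul_bdd (c := b) ((h.adapted k).mono (hle _) le_rfl).aestronglyMeasurable
        (Filter.Eventually.of_forall (h.bound k))
    calc ∫ ω, Real.exp (θ * ∑ i ∈ Finset.range (k + 1), D i ω) ∂P
        ≤ ∫ ω, (Real.exp (θ * ∑ i ∈ Finset.range k, D i ω) * Real.cosh (θ * b) +
            Real.exp (θ * ∑ i ∈ Finset.range k, D i ω) * D k ω * (Real.sinh (θ * b) / b)) ∂P := by
          refine integral_mono (hint _) (((hint k).mul_const _).add (hint2.mul_const _))
            fun ω => ?_
          dsimp only
          rw [Finset.sum_range_succ, mul_add, Real.exp_add, mul_assoc (Real.exp _) (D k ω),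
            ← mul_add]
          exact mul_le_mul_of_nonneg_left (exp_mul_le_cosh_add_sinh hb (h.bound k ω) θ)
            (Real.exp_pos _).le
      _ = (∫ ω, Real.exp (θ * ∑ i ∈ Finset.range k, D i ω) ∂P) * Real.cosh (θ * b) := by
          rw [integral_add ((hint k).mul_const _) (hint2.mul_const _), integral_mul_const,
            integral_mul_const, h.orthogonal k _ _ (hmeas k) (hbd k), zero_mul, add_zero]
      _ ≤ Real.exp (k * ((θ * b) ^ 2 / 2)) * Real.exp ((θ * b) ^ 2 / 2) :=
          mul_le_mul ih (Real.cosh_le_exp_half_sq _) (Real.cosh_pos _).le (Real.exp_pos _).le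
      _ = _ := by rw [← Real.exp_add]; push_cast; ring_nf

/-- The Azuma–Hoeffding inequality. -/
theorem real_le_sum_le [IsProbabilityMeasure P] (h : BoundedIncrements P F D b) (hb : 0 < b)
    (hF : Monotone F)
    (hle : ∀ i, F i ≤ mΩ) {k N : ℕ} (hk : k ≤ N) (hN : 0 < N) {l : ℝ} (hl : 0 ≤ l) :
    P.real {ω | l ≤ ∑ i ∈ Finset.range k, D i ω} ≤ Real.exp (-(l ^ 2 / (2 * N * b ^ 2))) := by
  have hN' : (0 : ℝ) < N := by exact_mod_cast hN
  have hk' : (k : ℝ) ≤ N := by exact_mod_cast hk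
  -- The minimiser of `N (θ b)² / 2 - θ l`. The horizon `N` replaces `k` so that the bound is
  -- uniform over `k ≤ N`, ready for a union bound.
  set θ := l / (N * b ^ 2) with hθ
  have hθ0 : 0 ≤ θ := by positivity
  have hmeas : Measurable fun ω => Real.exp (θ * ∑ i ∈ Finset.range k, D i ω) :=
    Real.measurable_exp.comp (((h.measurable_sum hF k).mono (hle k) le_rfl).const_mul θ)
  have hint : Integrable (fun ω => Real.exp (θ * ∑ i ∈ Finset.range k, D i ω)) P := by
    refine Integrable.of_bound hmeas.aestronglyMeasurable (Real.exp (θ * (k * b)))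
      (Filter.Eventually.of_forall fun ω => ?_)
    rw [Real.norm_eq_abs, abs_of_pos (Real.exp_pos _), Real.exp_le_exp]
    exact mul_le_mul_of_nonneg_left ((le_abs_self _).trans (h.abs_sum_le k ω)) hθ0
  have h1 := mul_meas_ge_le_integral_of_nonneg
    (Filter.Eventually.of_forall fun ω => (Real.exp_pos (θ * ∑ i ∈ Finset.range k, D i ω)).le)
    hint (Real.exp (θ * l))
  have h2 : P.real {ω | l ≤ ∑ i ∈ Finset.range k, D i ω} ≤
      P.real {ω | Real.exp (θ * l) ≤ Real.exp (θ * ∑ i ∈ Finset.range k, D i ω)} := by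
    refine measureReal_mono fun ω hω => ?_
    exact Real.exp_le_exp.2 (mul_le_mul_of_nonneg_left hω hθ0)
  have h3 := h1.trans (h.integral_exp_le hb hF hle θ k)
  have h4 : P.real {ω | l ≤ ∑ i ∈ Finset.range k, D i ω} ≤
      Real.exp (k * ((θ * b) ^ 2 / 2)) * Real.exp (-(θ * l)) := by
    rw [Real.exp_neg, ← div_eq_mul_inv, le_div_iff₀ (Real.exp_pos _), mul_comm]
    exact (mul_le_mul_of_nonneg_left h2 (Real.exp_pos _).le).trans h3
  refine h4.trans ?_
  rw [← Real.exp_add, Real.exp_le_exp]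
  have h5 : (k : ℝ) * ((θ * b) ^ 2 / 2) ≤ N * ((θ * b) ^ 2 / 2) :=
    mul_le_mul_of_nonneg_right hk' (by positivity)
  have h6 : N * ((θ * b) ^ 2 / 2) + -(θ * l) = -(l ^ 2 / (2 * N * b ^ 2)) := by
    rw [hθ]; field_simp; ring
  linarith

theorem real_le_abs_sum_le [IsProbabilityMeasure P] (h : BoundedIncrements P F D b) (hb : 0 < b)
    (hF : Monotone F)
    (hle : ∀ i, F i ≤ mΩ) {k N : ℕ} (hk : k ≤ N) (hN : 0 < N) {l : ℝ} (hl : 0 ≤ l) :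
    P.real {ω | l ≤ |∑ i ∈ Finset.range k, D i ω|} ≤
      2 * Real.exp (-(l ^ 2 / (2 * N * b ^ 2))) := by
  have h1 := h.real_le_sum_le hb hF hle hk hN hl
  have h2 := h.neg.real_le_sum_le hb hF hle hk hN hl
  have h3 : {ω | l ≤ |∑ i ∈ Finset.range k, D i ω|} ⊆
      {ω | l ≤ ∑ i ∈ Finset.range k, D i ω} ∪ {ω | l ≤ ∑ i ∈ Finset.range k, -D i ω} := by
    intro ω hω
    rw [Set.mem_union, Set.mem_ofPred_eq, Set.mem_ofPred_eq, Finset.sum_neg_distrib]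
    exact le_abs.1 hω
  have h4 := (measureReal_mono h3 (measure_ne_top P _)).trans (measureReal_union_le _ _)
  linarith

end BoundedIncrements

/-! ### The deterministic contraction -/

/-- Perturbed recursion with drift towards `0`. -/
theorem abs_le_of_drift {x g G M : ℕ → ℝ} {A m e gbar gmin R : ℝ} {N : ℕ} (hA : 0 < A)
    (hm : 0 ≤ m) (he : 0 ≤ e) (hgmin : 0 ≤ gmin) (hN : 0 < N)
    (hrec : ∀ k < N, x (k + 1) - M (k + 1) = x k - M k + g k * G k)
    (hM : ∀ k ≤ N, |M k| ≤ m)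
    (hg : ∀ k < N, gmin ≤ g k ∧ g k ≤ gbar) (hgA : A * gbar ≤ 1)
    (hG1 : ∀ k < N, |G k| ≤ 1)
    (hGpos : ∀ k < N, 0 ≤ x k → G k ≤ -(A * x k) + e)
    (hGneg : ∀ k < N, x k ≤ 0 → -(A * x k) - e ≤ G k)
    (hx0 : |x 0| ≤ R) :
    |x N| ≤ 2 * m + e / A + gbar + (1 - A * gmin) ^ N * (R + m) := by
  have hgbar : 0 ≤ gbar := hgmin.trans ((hg 0 hN).1.trans (hg 0 hN).2)
  have hA1 : 0 ≤ 1 - A * gmin := by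
    have := mul_le_mul_of_nonneg_left ((hg 0 hN).1.trans (hg 0 hN).2) hA.le
    linarith
  -- Half-width of the dead zone: once `|x k - M k|` exceeds `θ`, the drift dominates both the noise
  -- shift `m` and the bias `e`.
  set θ := m + e / A with hθ
  have hθA : A * θ = A * m + e := by rw [hθ]; field_simp
  have hθ0 : 0 ≤ θ := by positivity
  have hR : 0 ≤ R := (abs_nonneg _).trans hx0
  -- The noise is subtracted so that the compensated sequence moves by `g k * G k` only. In the dead
  -- zone one step moves it by at most `gbar`; outside, its excess over `θ` shrinks by the factor `1
  -- - A * g k`, without overshoot since `A * gbar ≤ 1`.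
  have key : ∀ k ≤ N, |x k - M k| ≤ θ + gbar + (1 - A * gmin) ^ k * (R + m) := by
    intro k
    induction k with
    | zero =>
      intro _
      have h1 := abs_sub (x 0) (M 0)
      have h2 := hM 0 (Nat.zero_le _)
      rw [pow_zero, one_mul]
      linarith
    | succ k ih =>
      intro hk
      have hk' : k < N := hk
      have ih' := ih hk'.le
      set V := (1 - A * gmin) ^ k * (R + m) with hV
      have hV0 : 0 ≤ V := mul_nonneg (pow_nonneg hA1 k) (by linarith)
      have hV' : (1 - A * gmin) ^ (k + 1) * (R + m) = (1 - A * gmin) * V := by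
        rw [hV, pow_succ]; ring
      have hV1 : 0 ≤ (1 - A * gmin) * V := mul_nonneg hA1 hV0
      rw [hV', hrec k hk']
      obtain ⟨hM1, hM2⟩ := abs_le.1 (hM k hk'.le)
      obtain ⟨hG2, hG3⟩ := abs_le.1 (hG1 k hk')
      obtain ⟨hg1, hg2⟩ := hg k hk'
      have hg0 : 0 ≤ g k := hgmin.trans hg1
      set y := x k - M k with hy
      have hgG1 : g k * G k ≤ gbar := by nlinarith
      have hgG2 : -gbar ≤ g k * G k := by nlinarith
      have hAg : A * g k ≤ 1 := (mul_le_mul_of_nonneg_left hg2 hA.le).trans hgA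
      have hAgV : A * gmin * V ≤ A * g k * V :=
        mul_le_mul_of_nonneg_right (mul_le_mul_of_nonneg_left hg1 hA.le) hV0
      obtain ⟨ih1, ih2⟩ := abs_le.1 ih'
      rw [abs_le]
      rcases le_or_gt y θ with h1 | h1
      · rcases le_or_gt (-θ) y with h2 | h2
        · constructor <;> linarith
        · have hx : x k ≤ 0 := by
            have : 0 ≤ e / A := by positivity
            linarith
          have h3 : A * (-y - θ) ≤ G k := by
            have := hGneg k hk' hx
            have h4 : A * M k ≤ A * m := mul_le_mul_of_nonneg_left (by linarith) hA.le
            have h5 : A * x k = A * y + A * M k := by rw [hy]; ring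
            linarith
          have h4 : g k * (A * (-y - θ)) ≤ g k * G k := mul_le_mul_of_nonneg_left h3 hg0
          have h5 : (1 - A * g k) * (-y - θ) ≤ (1 - A * g k) * (gbar + V) :=
            mul_le_mul_of_nonneg_left (by linarith) (by linarith)
          have h6 : 0 ≤ A * g k * gbar := mul_nonneg (mul_nonneg hA.le hg0) hgbar
          constructor <;> nlinarith
      · have hx : 0 ≤ x k := by
          have : 0 ≤ e / A := by positivity
          linarith
        have h3 : G k ≤ -(A * (y - θ)) := by
          have := hGpos k hk' hx
          have h4 : A * (-M k) ≤ A * m := mul_le_mul_of_nonneg_left (by linarith) hA.le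
          have h5 : A * x k = A * y + A * M k := by rw [hy]; ring
          linarith
        have h4 : g k * G k ≤ g k * -(A * (y - θ)) := mul_le_mul_of_nonneg_left h3 hg0
        have h5 : (1 - A * g k) * (y - θ) ≤ (1 - A * g k) * (gbar + V) :=
          mul_le_mul_of_nonneg_left (by linarith) (by linarith)
        have h6 : 0 ≤ A * g k * gbar := mul_nonneg (mul_nonneg hA.le hg0) hgbar
        constructor <;> nlinarith
  have h1 := key N le_rfl
  have h2 := hM N le_rfl
  have h3 := abs_add_le (x N - M N) (M N)
  rw [sub_add_cancel] at h3
  linarith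

/-! ### From the oracle to an estimated selection rule -/

section Law

variable {d : ℕ} {μ : Measure (Example d)} [IsProbabilityMeasure μ]

theorem measurable_lfdr : Measurable (lfdr μ) :=
  (Kernel.measurable_coe _ (measurableSet_singleton _)).ennreal_toReal

theorem lfdr_mem_Icc (x : Feature d) : lfdr μ x ∈ Set.Icc (0 : ℝ) 1 :=
  ⟨measureReal_nonneg, measureReal_le_one⟩

theorem measurable_oracleStat : Measurable (oracleStat μ) := measurable_lfdr.const_sub 1

theorem measurable_oracleStat_fst : Measurable fun z : Example d => oracleStat μ z.1 :=
  measurable_oracleStat.comp measurable_fst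

/-- Disintegration of `μ` along the feature: a weight depending on `x` alone sees the label only
through its conditional mean. -/
theorem integral_label_mul {g : Feature d → ℝ} (hg : Measurable g) {C : ℝ}
    (hb : ∀ x, |g x| ≤ C) :
    ∫ z, (if z.2 = 0 then 1 else 0) * g z.1 ∂μ = ∫ z, lfdr μ z.1 * g z.1 ∂μ := by
  have hS : MeasurableSet {z : Example d | z.2 = 0} := measurable_snd (measurableSet_singleton 0)
  have hm1 : Measurable fun z : Example d => (if z.2 = 0 then (1 : ℝ) else 0) * g z.1 :=
    (Measurable.ite hS measurable_const measurable_const).mul (hg.comp measurable_fst)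
  have hm2 : Measurable fun x : Feature d => lfdr μ x * g x := measurable_lfdr.mul hg
  have hint : Integrable (fun z : Example d => (if z.2 = 0 then (1 : ℝ) else 0) * g z.1) μ := by
    refine Integrable.of_bound hm1.aestronglyMeasurable C (Filter.Eventually.of_forall fun z => ?_)
    rw [Real.norm_eq_abs]
    split_ifs
    · simpa using hb z.1
    · simpa using (abs_nonneg _).trans (hb z.1)
  have h1 := μ.disintegrate μ.condKernel
  have h2 : ∫ z, lfdr μ z.1 * g z.1 ∂μ = ∫ x, lfdr μ x * g x ∂μ.fst :=
    (integral_map measurable_fst.aemeasurable hm2.aestronglyMeasurable).symm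
  rw [h2]
  conv_lhs => rw [← h1]
  rw [Measure.integral_compProd (by rwa [h1])]
  refine integral_congr_ae (Filter.Eventually.of_forall fun x => ?_)
  dsimp only
  rw [integral_mul_const]
  congr 1
  have h3 : (fun y : Fin 2 => if y = 0 then (1 : ℝ) else 0) =
      ({0} : Set (Fin 2)).indicator fun _ => 1 := by
    ext y; simp [Set.indicator_apply]
  rw [h3, integral_indicator_const _ (measurableSet_singleton _), smul_eq_mul, mul_one, lfdr]

theorem integral_lfdr : ∫ z, lfdr μ z.1 ∂μ = μ.real {z | z.2 = 0} := by
  have h := integral_label_mul (μ := μ) (g := fun _ => 1) measurable_const (C := 1) (by simp)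
  simp only [mul_one] at h
  rw [← h]
  have h3 : (fun z : Example d => if z.2 = 0 then (1 : ℝ) else 0) =
      {z : Example d | z.2 = 0}.indicator fun _ => 1 := by
    ext z; simp [Set.indicator_apply]
  have hS : MeasurableSet {z : Example d | z.2 = 0} := measurable_snd (measurableSet_singleton 0)
  rw [h3, integral_indicator_const _ hS, smul_eq_mul, mul_one]

/-- The law of `W(X)`. -/
noncomputable abbrev oracleLaw (μ : Measure (Example d)) [IsProbabilityMeasure μ] : Measure ℝ :=
  μ.map fun z => oracleStat μ z.1

instance : IsProbabilityMeasure (oracleLaw μ) :=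
  Measure.isProbabilityMeasure_map measurable_oracleStat_fst.aemeasurable

theorem tailDrift_oracleLaw (a q : ℝ) :
    tailDrift (oracleLaw μ) a q =
      ∫ z, (a - oracleStat μ z.1) * (if q < oracleStat μ z.1 then 1 else 0) ∂μ := by
  unfold tailDrift
  rw [← integral_indicator measurableSet_Ioi, integral_map measurable_oracleStat_fst.aemeasurable]
  · refine integral_congr_ae (Filter.Eventually.of_forall fun z => ?_)
    by_cases hz : q < oracleStat μ z.1 <;> simp [hz]
  · exact ((measurable_id.const_sub a).indicator measurableSet_Ioi).aestronglyMeasurable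

theorem oracleLaw_real_Ioi (q : ℝ) :
    (oracleLaw μ).real (Set.Ioi q) =
      ∫ z, (if q < oracleStat μ z.1 then 1 else 0) ∂μ := by
  have hS : MeasurableSet {z : Example d | q < oracleStat μ z.1} :=
    measurable_oracleStat_fst measurableSet_Ioi
  have h3 : (fun z : Example d => if q < oracleStat μ z.1 then (1 : ℝ) else 0) =
      {z : Example d | q < oracleStat μ z.1}.indicator fun _ => 1 := by
    ext z; simp [Set.indicator_apply]
  rw [h3, integral_indicator_const _ hS, smul_eq_mul, mul_one,
    map_measureReal_apply measurable_oracleStat_fst measurableSet_Ioi]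
  rfl

theorem HasDensityOn.real_Ioi_pos {ρ : Measure ℝ} [IsFiniteMeasure ρ] {f : ℝ → ℝ} {κ b : ℝ}
    (h : HasDensityOn ρ f κ b) (hκb : κ < b) {q : ℝ} (hq : q < b) : 0 < ρ.real (Set.Ioi q) := by
  refine (h.real_Ioc_pos (x := max κ q) (le_max_left _ _) (max_lt hκb hq) le_rfl).trans_le
    (measureReal_mono fun w hw => (le_max_right κ q).trans_lt hw.1)

variable {f : ℝ → ℝ} {κ Bs α : ℝ}

theorem meanAbove_eq_iff (h : HasDensityOn (oracleLaw μ) f κ Bs) (hκB : κ < Bs) {q : ℝ} (hq : q < Bs)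
    (a : ℝ) : meanAbove μ q = a ↔ tailDrift (oracleLaw μ) a q = 0 := by
  have hS : MeasurableSet {z : Example d | q < oracleStat μ z.1} :=
    measurable_oracleStat_fst measurableSet_Ioi
  have hp := h.real_Ioi_pos hκB hq
  have h1 : meanAbove μ q =
      ((oracleLaw μ).real (Set.Ioi q))⁻¹ * ∫ w in Set.Ioi q, w ∂(oracleLaw μ) := by
    unfold meanAbove ProbabilityTheory.cond
    rw [integral_smul_measure, smul_eq_mul, ENNReal.toReal_inv,
      setIntegral_map (f := fun w => w) measurableSet_Ioi measurable_id.aestronglyMeasurable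
        measurable_oracleStat_fst.aemeasurable,
      map_measureReal_apply measurable_oracleStat_fst measurableSet_Ioi]
    rfl
  have hint : Integrable (fun w => w) (oracleLaw μ) :=
    Integrable.of_mem_Icc κ Bs measurable_id.aemeasurable h.ae_mem
  have h2 : tailDrift (oracleLaw μ) a q =
      a * (oracleLaw μ).real (Set.Ioi q) - ∫ w in Set.Ioi q, w ∂(oracleLaw μ) := by
    unfold tailDrift
    rw [integral_sub (integrable_const _).integrableOn hint.integrableOn, setIntegral_const,
      smul_eq_mul, mul_comm]
  rw [h1, h2, inv_mul_eq_iff_eq_mul₀ hp.ne', sub_eq_zero, mul_comm, eq_comm]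

/-- The law has no atom at `κ`, so the restriction to `w > κ` is harmless and the integral is the
full mean of `lfdr(X) - α`. -/
theorem tailDrift_left (h : HasDensityOn (oracleLaw μ) f κ Bs) :
    tailDrift (oracleLaw μ) (1 - α) κ = μ.real {z | z.2 = 0} - α := by
  obtain ⟨K, hK0, hK⟩ := h.exists_bound
  have h0 : ∀ᵐ w ∂(oracleLaw μ), w ∈ Set.Ioi κ := by
    have h1 : (oracleLaw μ).real (Set.Icc κ κ) ≤ 0 := by
      simpa using h.real_le hK0.le hK (le_refl κ)
    have h2 : oracleLaw μ (Set.Icc κ κ) = 0 :=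
      (measureReal_eq_zero_iff).1 (le_antisymm h1 measureReal_nonneg)
    have h3 : ∀ᵐ w ∂(oracleLaw μ), w ∉ Set.Icc κ κ := measure_eq_zero_iff_ae_notMem.1 h2
    filter_upwards [h3, h.ae_mem] with w hw hw'
    refine lt_of_le_of_ne hw'.1 fun e => hw ?_
    rw [e]; exact ⟨le_rfl, le_rfl⟩
  unfold tailDrift
  rw [Measure.restrict_eq_self_of_ae_mem h0, integral_map (f := fun w => 1 - α - w)
    measurable_oracleStat_fst.aemeasurable (by fun_prop), ← integral_lfdr]
  have h4 : Integrable (fun z : Example d => lfdr μ z.1) μ := by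
    refine Integrable.of_bound (measurable_lfdr.comp measurable_fst).aestronglyMeasurable 1
      (Filter.Eventually.of_forall fun z => ?_)
    rw [Real.norm_eq_abs, abs_of_nonneg (lfdr_mem_Icc _).1]
    exact (lfdr_mem_Icc _).2
  have h5 : ∀ z : Example d, 1 - α - oracleStat μ z.1 = lfdr μ z.1 - α := fun z => by
    unfold oracleStat; ring
  simp only [h5]
  rw [integral_sub h4 (integrable_const _)]
  simp

theorem measurableSet_selection {v : Feature d → ℝ} (hv : Measurable v) (q : ℝ) :
    MeasurableSet {z : Example d | v z.1 < 1 - q} :=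
  measurableSet_lt (hv.comp measurable_fst) measurable_const

/-- An estimator within `e` of `lfdr` on average selects almost the same points. -/
theorem real_selection_ne_le (h : HasDensityOn (oracleLaw μ) f κ Bs) {K : ℝ} (hK0 : 0 ≤ K)
    (hK : ∀ w, f w ≤ K) {v : Feature d → ℝ} (hv : Measurable v) (hv' : ∀ x, v x ∈ Set.Icc (0 : ℝ) 1)
    {ε : ℝ} (hε : 0 < ε) (he : ∫ z, |v z.1 - lfdr μ z.1| ∂μ ≤ ε ^ 2) (q : ℝ) :
    μ.real {z | ¬(v z.1 < 1 - q ↔ q < oracleStat μ z.1)} ≤ (2 * K + 1) * ε := by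
  have hm : Measurable fun z : Example d => |v z.1 - lfdr μ z.1| :=
    ((hv.comp measurable_fst).sub (measurable_lfdr.comp measurable_fst)).abs
  have h1 := mul_meas_ge_le_integral_of_nonneg (μ := μ) (f := fun z => |v z.1 - lfdr μ z.1|)
    (Filter.Eventually.of_forall fun z => abs_nonneg _)
    (Integrable.of_bound hm.aestronglyMeasurable 1 (Filter.Eventually.of_forall fun z => by
      have h2 := hv' z.1
      have h3 := lfdr_mem_Icc (μ := μ) z.1
      rw [Real.norm_eq_abs, abs_abs, abs_le]
      constructor <;> linarith [h2.1, h2.2, h3.1, h3.2])) ε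
  have h2 : μ.real {z | ε ≤ |v z.1 - lfdr μ z.1|} ≤ ε := by
    have := h1.trans he
    rw [pow_two] at this
    exact le_of_mul_le_mul_left this hε
  have h3 := h.real_le hK0 hK (by linarith : q - ε ≤ q + ε)
  rw [map_measureReal_apply measurable_oracleStat_fst measurableSet_Icc] at h3
  -- The two rules can disagree only if the estimator errs by at least `ε`, which has probability at
  -- most `ε² / ε` by Markov, or if `W` lies within `ε` of `q`, which has probability at most `2 K
  -- ε`.
  have h4 : {z : Example d | ¬(v z.1 < 1 - q ↔ q < oracleStat μ z.1)} ⊆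
      {z | ε ≤ |v z.1 - lfdr μ z.1|} ∪
        (fun z : Example d => oracleStat μ z.1) ⁻¹' Set.Icc (q - ε) (q + ε) := by
    intro z hz
    by_contra hcon
    simp only [Set.mem_union, Set.mem_ofPred_eq, Set.mem_preimage, Set.mem_Icc, not_or, not_le,
      not_and_or] at hcon
    obtain ⟨ha, hb⟩ := hcon
    obtain ⟨ha1, ha2⟩ := abs_lt.1 ha
    refine hz ?_
    unfold oracleStat at hb ⊢
    rcases hb with hb | hb
    · exact ⟨fun _ => by linarith, fun _ => by linarith⟩
    · exact ⟨fun _ => by linarith, fun _ => by linarith⟩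
  have h5 := (measureReal_mono h4 (measure_ne_top μ _)).trans (measureReal_union_le _ _)
  nlinarith

theorem abs_integral_selection_sub_le {v : Feature d → ℝ} (hv : Measurable v) (q : ℝ)
    {g : Example d → ℝ} (hg : Measurable g) (hg1 : ∀ z, |g z| ≤ 1) :
    |∫ z, g z * (if v z.1 < 1 - q then 1 else 0) ∂μ -
        ∫ z, g z * (if q < oracleStat μ z.1 then 1 else 0) ∂μ| ≤
      μ.real {z | ¬(v z.1 < 1 - q ↔ q < oracleStat μ z.1)} := by
  have hA := measurableSet_selection hv q
  have hB : MeasurableSet {z : Example d | q < oracleStat μ z.1} :=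
    measurable_oracleStat_fst measurableSet_Ioi
  have hint : ∀ S : Set (Example d), [DecidablePred (· ∈ S)] → MeasurableSet S →
      Integrable (fun z => g z * (if z ∈ S then 1 else 0)) μ := by
    intro S _ hS
    refine Integrable.of_bound (hg.mul (Measurable.ite hS measurable_const
      measurable_const)).aestronglyMeasurable 1 (Filter.Eventually.of_forall fun z => ?_)
    rw [Real.norm_eq_abs]
    split_ifs
    · simpa using hg1 z
    · simp
  classical
  have hN : MeasurableSet {z : Example d | ¬(v z.1 < 1 - q ↔ q < oracleStat μ z.1)} := by
    have : {z : Example d | ¬(v z.1 < 1 - q ↔ q < oracleStat μ z.1)} =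
        ({z : Example d | v z.1 < 1 - q} \ {z | q < oracleStat μ z.1}) ∪
          ({z : Example d | q < oracleStat μ z.1} \ {z | v z.1 < 1 - q}) := by
      ext z
      simp only [Set.mem_union, Set.mem_sdiff, Set.mem_ofPred_eq]
      tauto
    rw [this]
    exact (hA.diff hB).union (hB.diff hA)
  have e1 := hint {z | v z.1 < 1 - q} hA
  have e2 := hint {z | q < oracleStat μ z.1} hB
  simp only [Set.mem_ofPred_eq] at e1 e2
  have h1 : ∫ z, g z * (if v z.1 < 1 - q then 1 else 0) ∂μ -
        ∫ z, g z * (if q < oracleStat μ z.1 then 1 else 0) ∂μ =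
      ∫ z, (g z * (if v z.1 < 1 - q then 1 else 0) -
        g z * (if q < oracleStat μ z.1 then 1 else 0)) ∂μ := by
    rw [integral_sub]
    · convert e1
    · convert e2
  have h2 : ∫ z, {z : Example d | ¬(v z.1 < 1 - q ↔ q < oracleStat μ z.1)}.indicator
      (fun _ => (1 : ℝ)) z ∂μ = μ.real {z | ¬(v z.1 < 1 - q ↔ q < oracleStat μ z.1)} := by
    rw [integral_indicator_const _ hN, smul_eq_mul, mul_one]
  rw [h1, ← h2, ← Real.norm_eq_abs]
  refine norm_integral_le_of_norm_le ((integrable_const (μ := μ) (1 : ℝ)).indicator hN)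
    (Filter.Eventually.of_forall fun z => ?_)
  rw [Real.norm_eq_abs]
  have := hg1 z
  by_cases ha : v z.1 < 1 - q <;> by_cases hb : q < oracleStat μ z.1 <;>
    simp [ha, hb, this]

/-- The conditional probability of selection for the estimator `v` and the threshold `q`. -/
noncomputable def selProb (μ : Measure (Example d)) (v : Feature d → ℝ) (q : ℝ) : ℝ :=
  ∫ z, (if v z.1 < 1 - q then 1 else 0) ∂μ

/-- The mean increment of the threshold, per unit of step, when `q ≥ 0`. -/
noncomputable def selDrift (μ : Measure (Example d)) (v : Feature d → ℝ) (α q : ℝ) : ℝ :=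
  ∫ z, ((if z.2 = 0 then 1 else 0) - α) * (if v z.1 < 1 - q then 1 else 0) ∂μ

theorem abs_selProb_sub_le (h : HasDensityOn (oracleLaw μ) f κ Bs) {K : ℝ} (hK0 : 0 ≤ K)
    (hK : ∀ w, f w ≤ K) {v : Feature d → ℝ} (hv : Measurable v) (hv' : ∀ x, v x ∈ Set.Icc (0 : ℝ) 1)
    {ε : ℝ} (hε : 0 < ε) (he : ∫ z, |v z.1 - lfdr μ z.1| ∂μ ≤ ε ^ 2) (q : ℝ) :
    |selProb μ v q - (oracleLaw μ).real (Set.Ioi q)| ≤ (2 * K + 1) * ε := by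
  have h1 := abs_integral_selection_sub_le (μ := μ) hv q (g := fun _ => 1) measurable_const
    (by simp)
  simp only [one_mul] at h1
  rw [selProb, oracleLaw_real_Ioi]
  exact h1.trans (real_selection_ne_le h hK0 hK hv hv' hε he q)

/-- Selection depends on `x` only, so the label may be replaced by `lfdr`; the drift then differs
from the oracle one only through the selected set. -/
theorem selDrift_eq {v : Feature d → ℝ} (hv : Measurable v) (α q : ℝ) :
    selDrift μ v α q =
      ∫ z, (1 - α - oracleStat μ z.1) * (if v z.1 < 1 - q then 1 else 0) ∂μ := by
  have hA := measurableSet_selection hv q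
  have hg : Measurable fun x : Feature d => if v x < 1 - q then (1 : ℝ) else 0 :=
    Measurable.ite (measurableSet_lt hv measurable_const) measurable_const measurable_const
  have hb : ∀ x : Feature d, |if v x < 1 - q then (1 : ℝ) else 0| ≤ 1 := fun x => by
    split_ifs <;> simp
  have h1 := integral_label_mul (μ := μ) hg hb
  have hbd : ∀ u : Example d → ℝ, Measurable u → (∀ z, |u z| ≤ 1) →
      Integrable (fun z => u z * (if v z.1 < 1 - q then (1 : ℝ) else 0)) μ := by
    intro u hu hu1
    refine Integrable.of_bound (hu.mul (hg.comp measurable_fst)).aestronglyMeasurable 1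
      (Filter.Eventually.of_forall fun z => ?_)
    rw [Real.norm_eq_abs, abs_mul]
    exact mul_le_one₀ (hu1 z) (abs_nonneg _) (hb z.1)
  have hl := hbd (fun z => lfdr μ z.1) (measurable_lfdr.comp measurable_fst) fun z => by
    rw [abs_of_nonneg (lfdr_mem_Icc _).1]; exact (lfdr_mem_Icc _).2
  have hy := hbd (fun z => if z.2 = 0 then 1 else 0) (Measurable.ite
    (measurable_snd (measurableSet_singleton 0)) measurable_const measurable_const) fun z => by
    split_ifs <;> simp
  have h1' := (hbd (fun _ => 1) measurable_const (by simp)).const_mul α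
  have e : ∀ z : Example d, (1 - α - oracleStat μ z.1) * (if v z.1 < 1 - q then (1 : ℝ) else 0) =
      lfdr μ z.1 * (if v z.1 < 1 - q then (1 : ℝ) else 0) -
        α * (1 * (if v z.1 < 1 - q then (1 : ℝ) else 0)) := fun z => by
    unfold oracleStat; ring
  have e' : ∀ z : Example d, ((if z.2 = 0 then (1 : ℝ) else 0) - α) *
      (if v z.1 < 1 - q then (1 : ℝ) else 0) =
      (if z.2 = 0 then (1 : ℝ) else 0) * (if v z.1 < 1 - q then (1 : ℝ) else 0) -
        α * (1 * (if v z.1 < 1 - q then (1 : ℝ) else 0)) := fun z => by ring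
  unfold selDrift
  simp only [e, e']
  rw [integral_sub hl h1', integral_sub hy h1', h1]

theorem abs_selDrift_sub_le (h : HasDensityOn (oracleLaw μ) f κ Bs) {K : ℝ} (hK0 : 0 ≤ K)
    (hK : ∀ w, f w ≤ K) (hα : α ∈ Set.Icc (0 : ℝ) 1)
    {v : Feature d → ℝ} (hv : Measurable v) (hv' : ∀ x, v x ∈ Set.Icc (0 : ℝ) 1)
    {ε : ℝ} (hε : 0 < ε) (he : ∫ z, |v z.1 - lfdr μ z.1| ∂μ ≤ ε ^ 2) (q : ℝ) :
    |selDrift μ v α q - tailDrift (oracleLaw μ) (1 - α) q| ≤ (2 * K + 1) * ε := by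
  rw [selDrift_eq hv, tailDrift_oracleLaw]
  refine (abs_integral_selection_sub_le (μ := μ) hv q
    (measurable_oracleStat_fst.const_sub _) fun z => ?_).trans
    (real_selection_ne_le h hK0 hK hv hv' hε he q)
  have h3 := lfdr_mem_Icc (μ := μ) z.1
  unfold oracleStat
  rw [abs_le]
  constructor <;> linarith [hα.1, hα.2, h3.1, h3.2]

end Law

/-! ### Joint measurability of one step -/

section Measurability

variable {Ω : Type*} {d : ℕ} {m : MeasurableSpace Ω} {α : ℝ} {γ : ℕ → ℝ}

theorem measurable_react : Measurable fun p : Fin 2 × ℝ => react p.1 p.2 := by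
  refine Measurable.ite ?_ measurable_const measurable_const
  exact (measurable_snd measurableSet_Iio).union (measurable_fst (measurableSet_singleton 0))

theorem measurable_state_step {s : Ω → ℝ × ℕ} (hs : Measurable s) {h : Ω → ℝ} (hh : Measurable h)
    {y : Ω → Fin 2} (hy : Measurable y) :
    Measurable fun ω => if h ω < 1 - (s ω).1 then
      ((s ω).1 + γ (s ω).2 * (react (y ω) (s ω).1 - α), (s ω).2 + 1) else s ω := by
  refine Measurable.ite (measurableSet_lt hh (hs.fst.const_sub 1)) (Measurable.prodMk ?_ ?_) hs
  · exact hs.fst.add ((measurable_from_top.comp hs.snd).mul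
      ((measurable_react.comp (hy.prodMk hs.fst)).sub_const α))
  · exact (measurable_from_top (f := fun j : ℕ => j + 1)).comp hs.snd

theorem measurableSet_selected_section {q : Ω → ℝ} (hq : Measurable q) {v : Ω × Feature d → ℝ}
    (hv : Measurable v) : MeasurableSet {p : Ω × Example d | v (p.1, p.2.1) < 1 - q p.1} :=
  measurableSet_lt (hv.comp (measurable_fst.prodMk measurable_snd.fst))
    ((hq.comp measurable_fst).const_sub 1)

theorem measurable_selected_section {q : Ω → ℝ} (hq : Measurable q) {v : Ω × Feature d → ℝ}
    (hv : Measurable v) : Measurable fun p : Ω × Example d =>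
      if v (p.1, p.2.1) < 1 - q p.1 then (1 : ℝ) else 0 :=
  Measurable.ite (measurableSet_selected_section hq hv) measurable_const measurable_const

theorem measurable_increment {q : Ω → ℝ} (hq : Measurable q) {v : Ω × Feature d → ℝ}
    (hv : Measurable v) : Measurable fun p : Ω × Example d =>
      (react p.2.2 (q p.1) - α) * (if v (p.1, p.2.1) < 1 - q p.1 then 1 else 0) :=
  ((measurable_react.comp (measurable_snd.snd.prodMk (hq.comp measurable_fst))).sub_const α).mul
    (measurable_selected_section hq hv)

theorem measurable_label_selected {q : Ω → ℝ} (hq : Measurable q) {v : Ω × Feature d → ℝ}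
    (hv : Measurable v) : Measurable fun p : Ω × Example d =>
      (if p.2.2 = 0 then (1 : ℝ) else 0) * (if v (p.1, p.2.1) < 1 - q p.1 then 1 else 0) :=
  (Measurable.ite (measurable_snd.snd (measurableSet_singleton 0))
    measurable_const measurable_const).mul
    (measurable_selected_section hq hv)

theorem measurable_abs_error {v : Ω × Feature d → ℝ} (hv : Measurable v) {g : Feature d → ℝ}
    (hg : Measurable g) : Measurable fun p : Ω × Example d => |v (p.1, p.2.1) - g p.2.1| :=
  ((hv.comp (measurable_fst.prodMk measurable_snd.fst)).sub (hg.comp measurable_snd.fst)).abs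

end Measurability

/-! ### The threshold, the selection counter and the conditional error rate -/

section Procedure

variable {Ω : Type*} {d n : ℕ} {α : ℝ} {γ : ℕ → ℝ} {q₁ : ℝ}
  {lfdrHat : ℕ → Ω → Feature d → ℝ} {X : ℕ → Ω → Feature d} {Y : ℕ → Ω → Fin 2}

/-- One plus the number of selections before time `t`. -/
noncomputable def counter (α : ℝ) (γ : ℕ → ℝ) (q₁ : ℝ) (lfdrHat : ℕ → Ω → Feature d → ℝ)
    (X : ℕ → Ω → Feature d) (Y : ℕ → Ω → Fin 2) (t : ℕ) (ω : Ω) : ℕ :=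
  (sciState α γ q₁ (fun k => lfdrHat k ω (X k ω)) (fun k => Y k ω) t).2

theorem threshold_succ (t : ℕ) (ω : Ω) :
    threshold α γ q₁ lfdrHat X Y (t + 2) ω = threshold α γ q₁ lfdrHat X Y (t + 1) ω +
      γ (counter α γ q₁ lfdrHat X Y (t + 1) ω) *
        ((react (Y (t + 1) ω) (threshold α γ q₁ lfdrHat X Y (t + 1) ω) - α) *
        (if lfdrHat (t + 1) ω (X (t + 1) ω) < 1 - threshold α γ q₁ lfdrHat X Y (t + 1) ω
          then 1 else 0)) := by
  unfold threshold counter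
  rw [sciState]
  split_ifs <;> simp

theorem counter_succ (t : ℕ) (ω : Ω) :
    counter α γ q₁ lfdrHat X Y (t + 2) ω = counter α γ q₁ lfdrHat X Y (t + 1) ω +
      (if lfdrHat (t + 1) ω (X (t + 1) ω) < 1 - threshold α γ q₁ lfdrHat X Y (t + 1) ω
          then 1 else 0) := by
  unfold threshold counter
  rw [sciState]
  split_ifs <;> simp

theorem counter_mono_succ (t : ℕ) (ω : Ω) :
    counter α γ q₁ lfdrHat X Y (t + 1) ω ≤ counter α γ q₁ lfdrHat X Y (t + 2) ω := by
  rw [counter_succ]; exact Nat.le_add_right _ _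

theorem counter_mono (ω : Ω) : Monotone fun t => counter α γ q₁ lfdrHat X Y (t + 1) ω :=
  monotone_nat_of_le_succ fun t => counter_mono_succ t ω

theorem one_le_counter (t : ℕ) (ω : Ω) : 1 ≤ counter α γ q₁ lfdrHat X Y (t + 1) ω :=
  counter_mono (α := α) (γ := γ) (q₁ := q₁) (lfdrHat := lfdrHat) (X := X) (Y := Y) ω
    (Nat.zero_le t)

theorem counter_le (t : ℕ) (ω : Ω) : counter α γ q₁ lfdrHat X Y (t + 1) ω ≤ t + 1 := by
  induction t with
  | zero => exact le_rfl
  | succ t ih => rw [counter_succ]; split_ifs <;> omega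

theorem react_sub_mem (hα : α ∈ Set.Ioo (0 : ℝ) 1) (y : Fin 2) (q : ℝ) :
    |react y q - α| ≤ 1 := by
  unfold react
  rw [abs_le]
  split_ifs <;> constructor <;> linarith [hα.1, hα.2]

theorem abs_increment_le (hα : α ∈ Set.Ioo (0 : ℝ) 1) (y : Fin 2) (q : ℝ) (p : Prop)
    [Decidable p] : |(react y q - α) * (if p then 1 else 0)| ≤ 1 := by
  have := react_sub_mem hα y q
  split_ifs <;> simp [this]

/-- A negative threshold can only increase, because the reaction is then `1 > α`; a nonnegative one
drops by at most one step, hence by at most `c`. -/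
theorem neg_le_threshold {c : ℝ} (hc : 0 ≤ c) (hα : α ∈ Set.Ioo (0 : ℝ) 1) (hq₁ : 0 ≤ q₁)
    (hγ0 : ∀ j, 1 ≤ j → 0 ≤ γ j) (hγ : ∀ j, 1 ≤ j → γ j ≤ c) (t : ℕ) (ω : Ω) :
    -c ≤ threshold α γ q₁ lfdrHat X Y (t + 1) ω := by
  induction t with
  | zero => exact (neg_nonpos.2 hc).trans hq₁
  | succ t ih =>
    rw [threshold_succ]
    set q := threshold α γ q₁ lfdrHat X Y (t + 1) ω
    have hJ := one_le_counter (α := α) (γ := γ) (q₁ := q₁) (lfdrHat := lfdrHat) (X := X) (Y := Y)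
      t ω
    set g := γ (counter α γ q₁ lfdrHat X Y (t + 1) ω)
    have h0 : 0 ≤ g := hγ0 _ hJ
    have h1 : g ≤ c := hγ _ hJ
    rcases lt_or_ge q 0 with hq | hq
    · have : react (Y (t + 1) ω) q = 1 := by simp [react, hq]
      rw [this]
      have h2 : 0 ≤ (1 - α) *
          (if lfdrHat (t + 1) ω (X (t + 1) ω) < 1 - q then (1 : ℝ) else 0) :=
        mul_nonneg (by linarith [hα.2]) (by split_ifs <;> norm_num)
      nlinarith [mul_nonneg h0 h2]
    · have h2 := (abs_le.1 (abs_increment_le hα (Y (t + 1) ω) q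
        (lfdrHat (t + 1) ω (X (t + 1) ω) < 1 - q))).1
      have h3 := mul_le_mul_of_nonneg_left h2 h0
      linarith

/-- The standing assumptions on the stream and on the estimators. -/
structure IsStream [MeasurableSpace Ω] (P : Measure Ω) (μ : Measure (Example d))
    (D : Fin n → Ω → Example d) (X : ℕ → Ω → Feature d) (Y : ℕ → Ω → Fin 2)
    (lfdrHat : ℕ → Ω → Feature d → ℝ) : Prop where
  measD : ∀ i, Measurable (D i)
  measX : ∀ t, Measurable (X t)
  measY : ∀ t, Measurable (Y t)
  law : ∀ t, P.map (fun ω => (X (t + 1) ω, Y (t + 1) ω)) = μ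
  indep : ∀ t, Indep (history D X Y t)
      (MeasurableSpace.comap (fun ω => (X (t + 1) ω, Y (t + 1) ω)) inferInstance) P
  measHat : ∀ t, Measurable[(history D X Y t).prod inferInstance]
      (fun p : Ω × Feature d => lfdrHat (t + 1) p.1 p.2)
  hat_mem : ∀ t ω x, lfdrHat (t + 1) ω x ∈ Set.Icc (0 : ℝ) 1

namespace IsStream

variable [mΩ : MeasurableSpace Ω] {P : Measure Ω}
  {μ : Measure (Example d)} {D : Fin n → Ω → Example d}

theorem history_le (S : IsStream P μ D X Y lfdrHat) (t : ℕ) : history D X Y t ≤ mΩ :=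
  OnlineTesting.history_le S.measD S.measX S.measY t

theorem measurable_pair (S : IsStream P μ D X Y lfdrHat) (t : ℕ) :
    Measurable fun ω => (X t ω, Y t ω) := (S.measX t).prodMk (S.measY t)

theorem measurable_hat_section (S : IsStream P μ D X Y lfdrHat) (t : ℕ) (ω : Ω) :
    Measurable (lfdrHat (t + 1) ω) :=
  (S.measHat t).comp (@measurable_prodMk_left Ω (Feature d) (history D X Y t) _ ω)

theorem measurable_state (S : IsStream P μ D X Y lfdrHat) (t : ℕ) :
    Measurable[history D X Y t] fun ω =>
      sciState α γ q₁ (fun k => lfdrHat k ω (X k ω)) (fun k => Y k ω) (t + 1) := by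
  induction t with
  | zero => exact measurable_const
  | succ t ih =>
    have hle := history_mono D X Y (Nat.le_succ t)
    have hpair := measurable_history_pair D X Y (Nat.le_add_left 1 t) (le_refl (t + 1))
    have hX : Measurable[history D X Y (t + 1)] (X (t + 1)) := measurable_fst.comp hpair
    have hY : Measurable[history D X Y (t + 1)] (Y (t + 1)) := measurable_snd.comp hpair
    have h1 : Measurable[history D X Y (t + 1), (history D X Y t).prod inferInstance]
        fun ω => (ω, X (t + 1) ω) := (measurable_id'' hle).prodMk hX
    exact measurable_state_step (ih.mono hle le_rfl) ((S.measHat t).comp h1) hY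

theorem measurable_threshold (S : IsStream P μ D X Y lfdrHat) (t : ℕ) :
    Measurable[history D X Y t] (threshold α γ q₁ lfdrHat X Y (t + 1)) :=
  measurable_fst.comp (S.measurable_state t)

theorem measurable_counter (S : IsStream P μ D X Y lfdrHat) (t : ℕ) :
    Measurable[history D X Y t] (counter α γ q₁ lfdrHat X Y (t + 1)) :=
  measurable_snd.comp (S.measurable_state t)

/-- The filtration starts at `s`, so that sums over late windows are covered; `G` is a predictable
weight, the random step size in the main use. The factor `2` comes from centring a function bounded
by `1`. -/
theorem boundedIncrements [IsProbabilityMeasure P] [IsProbabilityMeasure μ]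
    (S : IsStream P μ D X Y lfdrHat) (s : ℕ)
    {φ : ℕ → Ω × Example d → ℝ}
    (hφ : ∀ t, Measurable[(history D X Y t).prod inferInstance] (φ t)) (hφ1 : ∀ t p, |φ t p| ≤ 1)
    {G : ℕ → Ω → ℝ} (hG : ∀ t, Measurable[history D X Y t] (G t)) {b : ℝ}
    (hGb : ∀ t ω, |G t ω| ≤ b) :
    BoundedIncrements P (fun i => history D X Y (s + i))
      (fun i ω => G (s + i) ω * (φ (s + i) (ω, (X (s + i + 1) ω, Y (s + i + 1) ω)) -
        ∫ z, φ (s + i) (ω, z) ∂μ)) (b * 2) where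
  adapted i := by
    have hle := history_mono D X Y (Nat.le_succ (s + i))
    have hpair := measurable_history_pair D X Y (Nat.le_add_left 1 (s + i)) (le_refl (s + i + 1))
    have h1 : Measurable[history D X Y (s + i + 1),
        (history D X Y (s + i)).prod inferInstance]
        fun ω => (ω, (X (s + i + 1) ω, Y (s + i + 1) ω)) := (measurable_id'' hle).prodMk hpair
    have h2 : Measurable[history D X Y (s + i)] fun ω => ∫ z, φ (s + i) (ω, z) ∂μ :=
      @measurable_integral_section Ω _ (history D X Y (s + i)) _ μ _ _ (hφ (s + i))
    exact ((hG _).mono hle le_rfl).mul (((hφ _).comp h1).sub (h2.mono hle le_rfl))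
  bound i ω := by
    rw [abs_mul]
    refine mul_le_mul (hGb _ _) ?_ (abs_nonneg _) ((abs_nonneg _).trans (hGb (s + i) ω))
    refine (abs_sub _ _).trans ?_
    have h1 := hφ1 (s + i) (ω, (X (s + i + 1) ω, Y (s + i + 1) ω))
    have h2 : |∫ z, φ (s + i) (ω, z) ∂μ| ≤ 1 := abs_integral_le_of_abs_le fun z => hφ1 _ _
    linarith
  orthogonal i H C hH hC := by
    have h1 := integral_mul_centered_of_indep (S.history_le (s + i))
      (S.measurable_pair (s + i + 1)) (S.indep (s + i)) (S.law (s + i)) (hφ (s + i)) (hφ1 (s + i))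
      (hH.mul (hG (s + i))) (C' := C * b) fun ω => by
        rw [Pi.mul_apply, abs_mul]
        exact mul_le_mul (hC ω) (hGb _ ω) (abs_nonneg _) ((abs_nonneg _).trans (hC ω))
    simpa only [Pi.mul_apply, mul_assoc] using h1

/-- The conditional mean of the increment of the threshold, per unit of step. -/
theorem integral_increment_of_nonneg (v : Feature d → ℝ) {q : ℝ} (hq : 0 ≤ q) :
    ∫ z, (react z.2 q - α) * (if v z.1 < 1 - q then 1 else 0) ∂μ = selDrift μ v α q := by
  unfold selDrift react
  simp only [not_lt.2 hq, false_or]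

/-- For `q < 0` every point is selected, since `v ≤ 1 < 1 - q`, and every reaction is `1`. -/
theorem integral_increment_of_neg [IsProbabilityMeasure μ] {v : Feature d → ℝ}
    (hv : ∀ x, v x ≤ 1) {q : ℝ} (hq : q < 0) :
    ∫ z, (react z.2 q - α) * (if v z.1 < 1 - q then 1 else 0) ∂μ = 1 - α := by
  have h1 : ∀ x, v x < 1 - q := fun x => by linarith [hv x]
  simp [react, hq, h1]

theorem IER_ae_eq [IsProbabilityMeasure P] [IsProbabilityMeasure μ]
    (S : IsStream P μ D X Y lfdrHat) (t : ℕ) :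
    IER P α γ q₁ lfdrHat D X Y (t + 1) =ᵐ[P] fun ω =>
      (∫ z, (if z.2 = 0 then 1 else 0) *
        (if lfdrHat (t + 1) ω z.1 < 1 - threshold α γ q₁ lfdrHat X Y (t + 1) ω
          then 1 else 0) ∂μ) /
      selProb μ (lfdrHat (t + 1) ω) (threshold α γ q₁ lfdrHat X Y (t + 1) ω) := by
  have hq := S.measurable_threshold (α := α) (γ := γ) (q₁ := q₁) t
  have h1 := condExp_ae_eq_integral_section (S.history_le t) (S.measurable_pair (t + 1))
    (S.indep t) (S.law t) (measurable_label_selected hq (S.measHat t)) (C := 1) fun p => by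
      split_ifs <;> simp
  have h2 := condExp_ae_eq_integral_section (S.history_le t) (S.measurable_pair (t + 1))
    (S.indep t) (S.law t) (measurable_selected_section hq (S.measHat t)) (C := 1) fun p => by
      split_ifs <;> simp
  have e1 : (({ω' | Y (t + 1) ω' = 0} ∩ selected α γ q₁ lfdrHat X Y (t + 1)).indicator
      fun _ => (1 : ℝ)) = fun ω => (if Y (t + 1) ω = 0 then (1 : ℝ) else 0) *
        (if lfdrHat (t + 1) ω (X (t + 1) ω) < 1 - threshold α γ q₁ lfdrHat X Y (t + 1) ω
          then 1 else 0) := by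
    ext ω
    by_cases ha : Y (t + 1) ω = 0 <;>
    by_cases hb : lfdrHat (t + 1) ω (X (t + 1) ω) < 1 - threshold α γ q₁ lfdrHat X Y (t + 1) ω <;>
      simp [selected, ha, hb]
  have e2 : ((selected α γ q₁ lfdrHat X Y (t + 1)).indicator fun _ => (1 : ℝ)) = fun ω =>
        (if lfdrHat (t + 1) ω (X (t + 1) ω) < 1 - threshold α γ q₁ lfdrHat X Y (t + 1) ω
          then 1 else 0) := by
    ext ω
    by_cases hb : lfdrHat (t + 1) ω (X (t + 1) ω) < 1 - threshold α γ q₁ lfdrHat X Y (t + 1) ω <;>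
      simp [selected, hb]
  filter_upwards [h1, h2] with ω h1 h2
  unfold IER condProbGiven selProb
  rw [e1, e2, Nat.add_sub_cancel]
  exact congrArg₂ (· / ·) h1 h2

theorem condExp_error_ae_eq [IsProbabilityMeasure P] [IsProbabilityMeasure μ]
    (S : IsStream P μ D X Y lfdrHat) (t : ℕ) :
    condExp (history D X Y t) P
        (fun ω => |lfdrHat (t + 1) ω (X (t + 1) ω) - lfdr μ (X (t + 1) ω)|) =ᵐ[P]
      fun ω => ∫ z, |lfdrHat (t + 1) ω z.1 - lfdr μ z.1| ∂μ :=
  condExp_ae_eq_integral_section (S.history_le t) (S.measurable_pair (t + 1))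
    (S.indep t) (S.law t) (measurable_abs_error (S.measHat t) measurable_lfdr) (C := 1) fun p => by
      have h2 := S.hat_mem t p.1 p.2.1
      have h3 := lfdr_mem_Icc (μ := μ) p.2.1
      rw [abs_abs, abs_le]
      constructor <;> linarith [h2.1, h2.2, h3.1, h3.2]

/-- The instantaneous false discovery rate is `α` plus the ratio of the drift to the probability
of selection. -/
theorem IER_sub_ae_eq [IsProbabilityMeasure P] [IsProbabilityMeasure μ]
    (S : IsStream P μ D X Y lfdrHat) (t : ℕ) : ∀ᵐ ω ∂P,
    0 < selProb μ (lfdrHat (t + 1) ω) (threshold α γ q₁ lfdrHat X Y (t + 1) ω) →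
    IER P α γ q₁ lfdrHat D X Y (t + 1) ω - α =
      selDrift μ (lfdrHat (t + 1) ω) α (threshold α γ q₁ lfdrHat X Y (t + 1) ω) /
      selProb μ (lfdrHat (t + 1) ω) (threshold α γ q₁ lfdrHat X Y (t + 1) ω) := by
  filter_upwards [S.IER_ae_eq (α := α) (γ := γ) (q₁ := q₁) t] with ω hω hpos
  rw [hω]
  set v := lfdrHat (t + 1) ω
  set q := threshold α γ q₁ lfdrHat X Y (t + 1) ω
  have hv : Measurable v := S.measurable_hat_section t ω
  have hsel := measurableSet_selection hv q
  have i1 : Integrable (fun z : Example d => if v z.1 < 1 - q then (1 : ℝ) else 0) μ :=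
    Integrable.of_bound (Measurable.ite hsel measurable_const
      measurable_const).aestronglyMeasurable 1 (Filter.Eventually.of_forall fun z => by
        split_ifs <;> simp)
  have i2 : Integrable (fun z : Example d => (if z.2 = 0 then (1 : ℝ) else 0) *
      if v z.1 < 1 - q then (1 : ℝ) else 0) μ :=
    Integrable.of_bound ((Measurable.ite (measurable_snd (measurableSet_singleton 0))
      measurable_const measurable_const).mul (Measurable.ite hsel measurable_const
      measurable_const)).aestronglyMeasurable 1 (Filter.Eventually.of_forall fun z => by
        split_ifs <;> simp)
  have h1 : selDrift μ v α q = ∫ z, (if z.2 = 0 then 1 else 0) *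
      (if v z.1 < 1 - q then 1 else 0) ∂μ - α * selProb μ v q := by
    unfold selDrift selProb
    simp only [sub_mul]
    rw [integral_sub i2 (i1.const_mul α), integral_const_mul]
  rw [h1, sub_div, mul_div_assoc, div_self hpos.ne', mul_one]

end IsStream

end Procedure

/-! ### Control of the paths: contraction, counting and noise -/

section Paths

variable {Ω : Type*} {d n : ℕ} {α : ℝ} {γ : ℕ → ℝ} {q₁ : ℝ}
  {lfdrHat : ℕ → Ω → Feature d → ℝ} {X : ℕ → Ω → Feature d} {Y : ℕ → Ω → Fin 2}

/-- The indicator of a selection at time `t + 1`, as a function of the past and of `(x, y)`. -/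
noncomputable def selAt (q : ℕ → Ω → ℝ) (lfdrHat : ℕ → Ω → Feature d → ℝ) (t : ℕ)
    (p : Ω × Example d) : ℝ :=
  if lfdrHat (t + 1) p.1 p.2.1 < 1 - q (t + 1) p.1 then 1 else 0

/-- The increment of the threshold at time `t + 1`, per unit of step, as a function of the past and
of `(x, y)`. -/
noncomputable def incrAt (α : ℝ) (q : ℕ → Ω → ℝ) (lfdrHat : ℕ → Ω → Feature d → ℝ) (t : ℕ)
    (p : Ω × Example d) : ℝ :=
  (react p.2.2 (q (t + 1) p.1) - α) *
    (if lfdrHat (t + 1) p.1 p.2.1 < 1 - q (t + 1) p.1 then 1 else 0)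

theorem abs_selAt_le (q : ℕ → Ω → ℝ) (t : ℕ) (p : Ω × Example d) : |selAt q lfdrHat t p| ≤ 1 := by
  unfold selAt; split_ifs <;> simp

theorem abs_incrAt_le (hα : α ∈ Set.Ioo (0 : ℝ) 1) (q : ℕ → Ω → ℝ) (t : ℕ) (p : Ω × Example d) :
    |incrAt α q lfdrHat t p| ≤ 1 := abs_increment_le hα _ _ _

theorem counter_eq_add_sum (u k : ℕ) (ω : Ω) :
    (counter α γ q₁ lfdrHat X Y (u + k + 1) ω : ℝ) = counter α γ q₁ lfdrHat X Y (u + 1) ω +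
      ∑ i ∈ Finset.range k, selAt (threshold α γ q₁ lfdrHat X Y) lfdrHat (u + i)
        (ω, (X (u + i + 1) ω, Y (u + i + 1) ω)) := by
  induction k with
  | zero => simp
  | succ k ih =>
    rw [Finset.sum_range_succ, ← add_assoc (_ : ℝ), ← ih, ← add_assoc u k 1, counter_succ]
    unfold selAt
    push_cast
    rfl

namespace IsStream

variable [mΩ : MeasurableSpace Ω] {P : Measure Ω} {μ : Measure (Example d)}
  {D : Fin n → Ω → Example d}

theorem measurable_selAt (S : IsStream P μ D X Y lfdrHat) (t : ℕ) :
    Measurable[(history D X Y t).prod inferInstance]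
      (selAt (threshold α γ q₁ lfdrHat X Y) lfdrHat t) :=
  measurable_selected_section (S.measurable_threshold t) (S.measHat t)

theorem measurable_incrAt (S : IsStream P μ D X Y lfdrHat) (t : ℕ) :
    Measurable[(history D X Y t).prod inferInstance]
      (incrAt α (threshold α γ q₁ lfdrHat X Y) lfdrHat t) :=
  measurable_increment (S.measurable_threshold t) (S.measHat t)

variable [IsProbabilityMeasure μ]

/-- Along a path on which estimators, martingale part and steps are under control, the threshold
contracts towards `q₀`. -/
theorem abs_threshold_sub_le (S : IsStream P μ D X Y lfdrHat) (hα : α ∈ Set.Ioo (0 : ℝ) 1)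
    {f : ℝ → ℝ} {κ Bs K A r c q₀ : ℝ}
    (h : HasDensityOn (oracleLaw μ) f κ Bs) (hκ : 0 ≤ κ) (hK0 : 0 ≤ K) (hK : ∀ w, f w ≤ K)
    (hq₀ : q₀ ∈ Set.Icc (0 : ℝ) 1) (hr : r ≤ 1) (hA : 0 < A) (hc : 0 ≤ c)
    (hdrift₁ : ∀ q ∈ Set.Icc (-c) q₀, A * (q₀ - q) ≤ tailDrift (oracleLaw μ) (1 - α) q)
    (hdrift₂ : ∀ q ∈ Set.Icc q₀ r, tailDrift (oracleLaw μ) (1 - α) q ≤ -(A * (q - q₀)))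
    {ω : Ω} {s N : ℕ} (hN : 0 < N) {ε m gmin gbar : ℝ} (hε : 0 < ε) (hm : 0 ≤ m)
    (hgmin : 0 ≤ gmin)
    (hq : ∀ k, threshold α γ q₁ lfdrHat X Y (k + 1) ω ∈ Set.Ici (-c))
    (hqr : ∀ i < N, threshold α γ q₁ lfdrHat X Y (s + i + 1) ω ≤ r)
    (herr : ∀ i < N, ∫ z, |lfdrHat (s + i + 1) ω z.1 - lfdr μ z.1| ∂μ ≤ ε ^ 2)
    (hM : ∀ k ≤ N, |∑ i ∈ Finset.range k, γ (counter α γ q₁ lfdrHat X Y (s + i + 1) ω) *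
        (incrAt α (threshold α γ q₁ lfdrHat X Y) lfdrHat (s + i)
            (ω, (X (s + i + 1) ω, Y (s + i + 1) ω)) -
          ∫ z, incrAt α (threshold α γ q₁ lfdrHat X Y) lfdrHat (s + i) (ω, z) ∂μ)| ≤ m)
    (hg : ∀ i < N, gmin ≤ γ (counter α γ q₁ lfdrHat X Y (s + i + 1) ω) ∧
      γ (counter α γ q₁ lfdrHat X Y (s + i + 1) ω) ≤ gbar) (hgA : A * gbar ≤ 1) :
    |threshold α γ q₁ lfdrHat X Y (s + N + 1) ω - q₀| ≤
      2 * m + (2 * K + 1) * ε / A + gbar + (1 - A * gmin) ^ N * (c + 1 + m) := by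
  set q := threshold α γ q₁ lfdrHat X Y with hqdef
  have key : ∀ i < N, (0 ≤ q (s + i + 1) ω → ∫ z, incrAt α q lfdrHat (s + i) (ω, z) ∂μ =
      selDrift μ (lfdrHat (s + i + 1) ω) α (q (s + i + 1) ω)) ∧
      |selDrift μ (lfdrHat (s + i + 1) ω) α (q (s + i + 1) ω) -
        tailDrift (oracleLaw μ) (1 - α) (q (s + i + 1) ω)| ≤ (2 * K + 1) * ε := fun i hi =>
    ⟨fun h0 => integral_increment_of_nonneg (μ := μ) (α := α) (lfdrHat (s + i + 1) ω) h0,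
      abs_selDrift_sub_le h hK0 hK ⟨hα.1.le, hα.2.le⟩ (S.measurable_hat_section _ ω)
        (S.hat_mem _ ω) hε (herr i hi) _⟩
  refine abs_le_of_drift (x := fun k => q (s + k + 1) ω - q₀)
    (g := fun k => γ (counter α γ q₁ lfdrHat X Y (s + k + 1) ω))
    (G := fun k => ∫ z, incrAt α q lfdrHat (s + k) (ω, z) ∂μ)
    (M := fun k => ∑ i ∈ Finset.range k, γ (counter α γ q₁ lfdrHat X Y (s + i + 1) ω) *
        (incrAt α q lfdrHat (s + i) (ω, (X (s + i + 1) ω, Y (s + i + 1) ω)) -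
          ∫ z, incrAt α q lfdrHat (s + i) (ω, z) ∂μ))
    hA hm (by positivity) hgmin hN ?_ hM hg hgA ?_ ?_ ?_ ?_
  · intro k _
    rw [Finset.sum_range_succ, ← add_assoc s k 1, hqdef, threshold_succ, ← hqdef]
    unfold incrAt
    ring
  · exact fun k _ => abs_integral_le_of_abs_le fun z => abs_incrAt_le hα _ _ _
  · intro k hk hx
    obtain ⟨k1, k2⟩ := key k hk
    rw [k1 (by linarith [hq₀.1])]
    have := hdrift₂ (q (s + k + 1) ω) ⟨by linarith, hqr k hk⟩
    linarith [(abs_le.1 k2).2]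
  · intro k hk hx
    obtain ⟨k1, k2⟩ := key k hk
    have h1 := hdrift₁ (q (s + k + 1) ω) ⟨hq _, by linarith⟩
    rcases le_or_gt 0 (q (s + k + 1) ω) with h0 | h0
    · rw [k1 h0]
      linarith [(abs_le.1 k2).1]
    -- At negative thresholds the actual drift is `1 - α`, which dominates the oracle drift because
    -- `w ≥ 0`; the lower bound survives without any estimation error.
    · have h2 : ∫ z, incrAt α q lfdrHat (s + k) (ω, z) ∂μ = 1 - α :=
        integral_increment_of_neg (fun x => (S.hat_mem (s + k) ω x).2) h0
      have h3 : tailDrift (oracleLaw μ) (1 - α) (q (s + k + 1) ω) ≤ 1 - α := by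
        have h4 : ∫ w in Set.Ioi (q (s + k + 1) ω), (1 - α - w) ∂(oracleLaw μ) ≤
            ∫ w in Set.Ioi (q (s + k + 1) ω), (1 - α) ∂(oracleLaw μ) := by
          refine integral_mono_ae (h.integrable _).integrableOn
            (integrable_const _).integrableOn ?_
          filter_upwards [ae_restrict_of_ae h.ae_mem] with w hw
          linarith [hw.1]
        rw [setIntegral_const, smul_eq_mul] at h4
        have h5 : (oracleLaw μ).real (Set.Ioi (q (s + k + 1) ω)) ≤ 1 := measureReal_le_one
        have h6 := mul_le_mul_of_nonneg_right h5 (sub_nonneg.2 hα.2.le)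
        rw [one_mul] at h6
        exact h4.trans h6
      have h7 : 0 ≤ (2 * K + 1) * ε := by positivity
      rw [h2]
      linarith
  -- The threshold lies in `[-c, 1]` and `q₀` in `[0, 1]`, so `R = c + 1` bounds the initial
  -- distance.
  · have h1 := hq s
    have h2 := hqr 0 hN
    rw [abs_le]
    simp only [add_zero, Set.mem_Ici] at h1 h2 ⊢
    constructor <;> linarith [hq₀.1, hq₀.2]

variable [IsProbabilityMeasure P]

/-- Few selections are unlikely while the conditional probability of selection is at least `p`. -/
theorem real_counter_lt_le (S : IsStream P μ D X Y lfdrHat) {p : ℝ} (hp : 0 < p) {N : ℕ}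
    (hN : 0 < N) (u : ℕ) :
    P.real {ω | (∀ i < N, p ≤ selProb μ (lfdrHat (u + i + 1) ω)
          (threshold α γ q₁ lfdrHat X Y (u + i + 1) ω)) ∧
        (counter α γ q₁ lfdrHat X Y (u + N + 1) ω : ℝ) < N * p / 2} ≤
      Real.exp (-(N * p ^ 2 / 32)) := by
  have hN' : (0 : ℝ) < N := by exact_mod_cast hN
  -- The compensator of the count is at least `N * p`; a count below half of that forces the negated
  -- martingale above `N * p / 2`.
  have h1 := (S.boundedIncrements u (S.measurable_selAt (α := α) (γ := γ) (q₁ := q₁))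
    (abs_selAt_le _) (G := fun _ _ => 1) (fun _ => measurable_const) (b := 1)
    (by simp)).neg.real_le_sum_le (by norm_num)
    (fun i j hij => history_mono D X Y (Nat.add_le_add_left hij u)) (fun i => S.history_le _)
    (le_refl N) hN (l := N * p / 2) (by positivity)
  have e : (N * p / 2) ^ 2 / (2 * N * (1 * 2) ^ 2) = N * p ^ 2 / 32 := by field_simp; ring
  rw [e] at h1
  refine (measureReal_mono (fun ω hω => ?_) (measure_ne_top P _)).trans h1
  obtain ⟨hsel, hcount⟩ := hω
  rw [counter_eq_add_sum] at hcount
  simp only [Set.mem_ofPred_eq, one_mul, neg_sub]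
  rw [Finset.sum_sub_distrib]
  have h2 : ∑ i ∈ Finset.range N, p ≤ ∑ i ∈ Finset.range N,
      ∫ z, selAt (threshold α γ q₁ lfdrHat X Y) lfdrHat (u + i) (ω, z) ∂μ :=
    Finset.sum_le_sum fun i hi => hsel i (Finset.mem_range.1 hi)
  rw [Finset.sum_const, Finset.card_range, nsmul_eq_mul] at h2
  have h3 : (0 : ℝ) ≤ counter α γ q₁ lfdrHat X Y (u + 1) ω := Nat.cast_nonneg _
  linarith

/-- The centred increments with steps truncated at `b`. -/
theorem real_exists_le_abs_sum_le (S : IsStream P μ D X Y lfdrHat) (hα : α ∈ Set.Ioo (0 : ℝ) 1)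
    (hγ : ∀ j, 1 ≤ j → 0 ≤ γ j) {b : ℝ} (hb : 0 < b) (s : ℕ) {N t : ℕ} (hNt : N < t) {l : ℝ}
    (hl : 0 ≤ l) :
    P.real {ω | ∃ k ≤ N, l ≤ |∑ i ∈ Finset.range k,
        min (γ (counter α γ q₁ lfdrHat X Y (s + i + 1) ω)) b *
        (incrAt α (threshold α γ q₁ lfdrHat X Y) lfdrHat (s + i)
            (ω, (X (s + i + 1) ω, Y (s + i + 1) ω)) -
          ∫ z, incrAt α (threshold α γ q₁ lfdrHat X Y) lfdrHat (s + i) (ω, z) ∂μ)|} ≤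
      t * (2 * Real.exp (-(l ^ 2 / (2 * t * (b * 2) ^ 2)))) := by
  have hBI := S.boundedIncrements s (S.measurable_incrAt (α := α) (γ := γ) (q₁ := q₁))
    (abs_incrAt_le hα _) (G := fun t ω => min (γ (counter α γ q₁ lfdrHat X Y (t + 1) ω)) b)
    (fun t => (measurable_from_top.comp (S.measurable_counter t)).min measurable_const) (b := b)
    (fun t ω => by
      rw [abs_of_nonneg (le_min (hγ _ (one_le_counter t ω)) hb.le)]
      exact min_le_right _ _)
  have h1 : ∀ k ∈ Finset.range (N + 1), _ := fun k hk => hBI.real_le_abs_sum_le (by positivity)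
    (fun i j hij => history_mono D X Y (Nat.add_le_add_left hij s)) (fun i => S.history_le _)
    (show k ≤ t by have := Finset.mem_range.1 hk; omega) (by omega) hl
  have h2 := Finset.sum_le_sum h1
  rw [Finset.sum_const, Finset.card_range, nsmul_eq_mul] at h2
  have h3 : ((N + 1 : ℕ) : ℝ) ≤ t := by exact_mod_cast hNt
  refine le_trans ?_ (h2.trans (mul_le_mul_of_nonneg_right h3 (by positivity)))
  refine le_trans (measureReal_mono ?_ (measure_ne_top P _))
    (measureReal_biUnion_finset_le (Finset.range (N + 1)) _)
  rintro ω ⟨k, hk, hω⟩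
  exact Set.mem_iUnion₂.2 ⟨k, Finset.mem_range.2 (Nat.lt_succ_of_le hk), hω⟩

/-- The conditional expectation in the rate assumption is a.e. the integral of the error over a
fresh example; a union bound over at most `τ + 1` times follows. -/
theorem real_exists_error_le (S : IsStream P μ D X Y lfdrHat) {a : ℕ → ℝ} {b : ℝ} {u τ : ℕ}
    (hest : ∀ k ∈ Finset.Icc u τ, P.real {ω | a k ≤ (condExp (history D X Y k) P
        fun ω' => |lfdrHat (k + 1) ω' (X (k + 1) ω') - lfdr μ (X (k + 1) ω')|) ω} ≤ b)
    (hb : 0 ≤ b) :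
    P.real {ω | ∃ k ∈ Finset.Icc u τ,
      a k ≤ ∫ z, |lfdrHat (k + 1) ω z.1 - lfdr μ z.1| ∂μ} ≤ (τ + 1) * b := by
  have h1 : ∀ k ∈ Finset.Icc u τ,
      P.real {ω | a k ≤ ∫ z, |lfdrHat (k + 1) ω z.1 - lfdr μ z.1| ∂μ} ≤ b := by
    intro k hk
    refine le_of_eq_of_le (measureReal_congr ?_) (hest k hk)
    filter_upwards [S.condExp_error_ae_eq k] with ω hω
    change (a k ≤ _) = (a k ≤ _)
    rw [hω]
  have h2 := Finset.sum_le_sum h1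
  rw [Finset.sum_const, nsmul_eq_mul] at h2
  have h3 : ((Finset.Icc u τ).card : ℝ) ≤ τ + 1 := by
    rw [Nat.card_Icc]; exact_mod_cast Nat.sub_le _ _
  refine le_trans ?_ (h2.trans (mul_le_mul_of_nonneg_right h3 hb))
  refine le_trans (measureReal_mono ?_ (measure_ne_top P _))
    (measureReal_biUnion_finset_le (Finset.Icc u τ) _)
  rintro ω ⟨k, hk, hω⟩
  exact Set.mem_iUnion₂.2 ⟨k, hk, hω⟩

end IsStream

end Paths

/-! ### The error bound at a fixed time -/

theorem exp_neg_le_inv {x : ℝ} (hx : 0 < x) : Real.exp (-x) ≤ x⁻¹ := by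
  rw [Real.exp_neg]
  exact inv_anti₀ hx (by linarith [Real.add_one_le_exp x])

namespace IsStream

variable {Ω : Type*} {d n : ℕ} {α : ℝ} {γ : ℕ → ℝ} {q₁ : ℝ}
  {lfdrHat : ℕ → Ω → Feature d → ℝ} {X : ℕ → Ω → Feature d} {Y : ℕ → Ω → Fin 2}
  [mΩ : MeasurableSpace Ω] {P : Measure Ω} {μ : Measure (Example d)}
  {D : Fin n → Ω → Example d} [IsProbabilityMeasure μ] [IsProbabilityMeasure P]

/-- The numerator of `IER - α` is the actual drift: up to the estimation error it is the oracle
drift, which is `K`-Lipschitz and vanishes at `q₀`. The denominator is at least `p`. -/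
theorem abs_IER_sub_le (S : IsStream P μ D X Y lfdrHat) (hα : α ∈ Set.Ioo (0 : ℝ) 1)
    {f : ℝ → ℝ} {κ Bs K p q₀ : ℝ}
    (h : HasDensityOn (oracleLaw μ) f κ Bs) (hκ : 0 ≤ κ) (hBs : Bs ≤ 1) (hK0 : 0 ≤ K) (hK : ∀ w, f w ≤ K)
    (hroot : tailDrift (oracleLaw μ) (1 - α) q₀ = 0) (hp : 0 < p) (t : ℕ) :
    ∀ᵐ ω ∂P, ∀ ε > 0, ∫ z, |lfdrHat (t + 1) ω z.1 - lfdr μ z.1| ∂μ ≤ ε ^ 2 →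
      p ≤ selProb μ (lfdrHat (t + 1) ω) (threshold α γ q₁ lfdrHat X Y (t + 1) ω) →
      |IER P α γ q₁ lfdrHat D X Y (t + 1) ω - α| ≤
        (K * |threshold α γ q₁ lfdrHat X Y (t + 1) ω - q₀| + (2 * K + 1) * ε) / p := by
  filter_upwards [S.IER_sub_ae_eq (α := α) (γ := γ) (q₁ := q₁) t] with ω hω ε hε herr hsel
  rw [hω (hp.trans_le hsel), abs_div, abs_of_pos (hp.trans_le hsel)]
  set q := threshold α γ q₁ lfdrHat X Y (t + 1) ω
  have h1 := abs_selDrift_sub_le h hK0 hK ⟨hα.1.le, hα.2.le⟩ (S.measurable_hat_section t ω)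
        (S.hat_mem t ω) hε herr q
  have h2 := h.abs_tailDrift_sub_le hK0 hK hκ hBs (a := 1 - α)
    ⟨by linarith [hα.2], by linarith [hα.1]⟩ q q₀
  rw [hroot, sub_zero] at h2
  have h3 := abs_add_le (selDrift μ (lfdrHat (t + 1) ω) α q - tailDrift (oracleLaw μ) (1 - α) q)
    (tailDrift (oracleLaw μ) (1 - α) q)
  rw [sub_add_cancel] at h3
  exact div_le_div₀ (by positivity) (by linarith) hp hsel

/-- The error bound at time `τ + 1`, outside an event `U` on which the threshold may be large. -/
theorem le_real_error_le (S : IsStream P μ D X Y lfdrHat) (hα : α ∈ Set.Ioo (0 : ℝ) 1)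
    {f : ℝ → ℝ} {κ Bs K A r c β q₀ p ε : ℝ}
    (h : HasDensityOn (oracleLaw μ) f κ Bs) (hκ : 0 ≤ κ) (hBs : Bs ≤ 1) (hK0 : 0 ≤ K) (hK : ∀ w, f w ≤ K)
    (hq₀ : q₀ ∈ Set.Icc (0 : ℝ) 1) (hr : r ≤ 1) (hA : 0 < A)
    (hroot : tailDrift (oracleLaw μ) (1 - α) q₀ = 0)
    (hdrift₁ : ∀ q ∈ Set.Icc (-c) q₀, A * (q₀ - q) ≤ tailDrift (oracleLaw μ) (1 - α) q)
    (hdrift₂ : ∀ q ∈ Set.Icc q₀ r, tailDrift (oracleLaw μ) (1 - α) q ≤ -(A * (q - q₀)))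
    (hc : 0 < c) (hβ : 0 < β) (hq₁ : 0 ≤ q₁) (hγ : ∀ j : ℕ, 1 ≤ j → γ j = c * (j : ℝ) ^ (-β))
    (hp : 0 < p) (hpr : 2 * p ≤ (oracleLaw μ).real (Set.Ioi r))
    {U : Set Ω} {t₀ τ : ℕ}
    (hU : ∀ ω ∉ U, ∀ T, t₀ ≤ T → threshold α γ q₁ lfdrHat X Y T ω ≤ r)
    (hτ : 5 ≤ τ) (hτ₀ : t₀ ≤ τ / 4) (hε : 0 < ε) (hεp : (2 * K + 1) * ε ≤ p)
    (hest : ∀ k ∈ Finset.Icc (τ / 4) τ, P.real {ω | ε ^ 2 ≤ (condExp (history D X Y k) P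
        fun ω' => |lfdrHat (k + 1) ω' (X (k + 1) ω') - lfdr μ (X (k + 1) ω')|) ω} ≤
      64 / ((τ : ℝ) + 1) ^ 2)
    {gbar gmin m : ℝ} (hgbar : gbar = c * (p / 16 * ((τ : ℝ) + 1)) ^ (-β))
    (hgmin : gmin = c * ((τ : ℝ) + 1) ^ (-β))
    (hm : m = 4 * gbar * Real.sqrt (((τ : ℝ) + 1) * Real.log ((τ : ℝ) + 1)))
    (hgA : A * gbar ≤ 1) :
    1 - P.real U - (66 + 256 / p ^ 2) / ((τ : ℝ) + 1) ≤
      P.real {ω | |IER P α γ q₁ lfdrHat D X Y (τ + 1) ω - α| +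
          |threshold α γ q₁ lfdrHat X Y (τ + 1) ω - q₀| ≤
        (K / p + 1) * (2 * m + (2 * K + 1) * ε / A + gbar +
          (1 - A * gmin) ^ (τ - τ / 2) * (c + 1 + m)) + (2 * K + 1) * ε / p} := by
  set q := threshold α γ q₁ lfdrHat X Y with hqdef
  -- Two windows: selections accumulate on `[τ/4, τ/2)`, which makes the steps small; the
  -- contraction then runs on `[τ/2, τ)`.
  set u := τ / 4 with hu
  set s := τ / 2 with hs
  set N := τ - s with hN
  obtain ⟨k₀, hk₀⟩ : ∃ k₀, s = u + k₀ := ⟨s - u, by omega⟩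
  have hk₀pos : 0 < k₀ := by omega
  have hsN : s + N = τ := by omega
  have hNpos : 0 < N := by omega
  set t : ℝ := (τ : ℝ) + 1 with ht
  have ht0 : 0 < t := by positivity
  have ht1 : 1 ≤ t := by rw [ht]; linarith [(Nat.cast_nonneg τ : (0 : ℝ) ≤ τ)]
  have hk₀t : t / 8 ≤ k₀ := by
    have : τ + 1 ≤ 8 * k₀ := by omega
    have : ((τ + 1 : ℕ) : ℝ) ≤ (8 * k₀ : ℕ) := by exact_mod_cast this
    push_cast at this
    rw [ht]; linarith
  have hgbar0 : 0 < gbar := by rw [hgbar]; positivity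
  have hgmin0 : 0 ≤ gmin := by rw [hgmin]; positivity
  have hlog0 : 0 ≤ Real.log t := Real.log_nonneg ht1
  have hm0 : 0 ≤ m := by rw [hm]; positivity
  have hγ0 : ∀ j, 1 ≤ j → 0 ≤ γ j := fun j hj => by rw [hγ j hj]; positivity
  have hγc : ∀ j, 1 ≤ j → γ j ≤ c := fun j hj => by
    rw [hγ j hj]
    have h1 : (1 : ℝ) ≤ j := by exact_mod_cast hj
    have := Real.rpow_le_one_of_one_le_of_nonpos h1 (neg_nonpos.2 hβ.le)
    nlinarith
  set B₁ : Set Ω := {ω | ∃ k ∈ Finset.Icc u τ,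
    ε ^ 2 ≤ ∫ z, |lfdrHat (k + 1) ω z.1 - lfdr μ z.1| ∂μ} with hB₁
  set B₂ : Set Ω := {ω | (∀ i < k₀, p ≤ selProb μ (lfdrHat (u + i + 1) ω) (q (u + i + 1) ω)) ∧
        (counter α γ q₁ lfdrHat X Y (u + k₀ + 1) ω : ℝ) < k₀ * p / 2} with hB₂
  -- Truncation at `gbar` bounds the weights on all of `Ω`, as Azuma–Hoeffding requires; off the
  -- other bad events the steps are below `gbar` and it has no effect.
  set B₃ : Set Ω := {ω | ∃ k ≤ N, m ≤ |∑ i ∈ Finset.range k,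
        min (γ (counter α γ q₁ lfdrHat X Y (s + i + 1) ω)) gbar *
        (incrAt α q lfdrHat (s + i) (ω, (X (s + i + 1) ω, Y (s + i + 1) ω)) -
          ∫ z, incrAt α q lfdrHat (s + i) (ω, z) ∂μ)|} with hB₃
  have hP₁ : P.real B₁ ≤ 64 / t := by
    refine (S.real_exists_error_le hest (by positivity)).trans (le_of_eq ?_)
    rw [← ht]; field_simp
  have hP₂ : P.real B₂ ≤ 256 / p ^ 2 / t := by
    refine (S.real_counter_lt_le hp hk₀pos u).trans ?_
    have h1 : t * p ^ 2 / 256 ≤ k₀ * p ^ 2 / 32 := by nlinarith [sq_nonneg p]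
    refine (Real.exp_le_exp.2 (neg_le_neg h1)).trans
      ((exp_neg_le_inv (by positivity)).trans (le_of_eq ?_))
    field_simp
  have hP₃ : P.real B₃ ≤ 2 / t := by
    have h1 := S.real_exists_le_abs_sum_le (α := α) (γ := γ) (q₁ := q₁) hα hγ0 hgbar0 s
      (show N < τ + 1 by omega) hm0
    refine h1.trans (le_of_eq ?_)
    push_cast
    rw [← ht]
    -- The factor `4` in `m` is chosen for this: each tail is `2 / t²`, and the union over at most
    -- `t` partial sums costs a factor `t`.
    have h2 : m ^ 2 / (2 * t * (gbar * 2) ^ 2) = 2 * Real.log t := by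
      rw [hm, mul_pow, Real.sq_sqrt (by positivity)]
      field_simp; ring
    rw [h2, Real.exp_neg, two_mul (Real.log t), Real.exp_add, Real.exp_log ht0]
    field_simp
  obtain ⟨Z, hZ0, hZ⟩ : ∃ Z : Set Ω, P.real Z = 0 ∧ ∀ ω ∉ Z, ∀ ε > 0,
      ∫ z, |lfdrHat (τ + 1) ω z.1 - lfdr μ z.1| ∂μ ≤ ε ^ 2 →
      p ≤ selProb μ (lfdrHat (τ + 1) ω) (q (τ + 1) ω) →
      |IER P α γ q₁ lfdrHat D X Y (τ + 1) ω - α| ≤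
        (K * |q (τ + 1) ω - q₀| + (2 * K + 1) * ε) / p :=
    ⟨_, (measureReal_eq_zero_iff (measure_ne_top P _)).2 (ae_iff.1
      (S.abs_IER_sub_le (γ := γ) (q₁ := q₁) hα h hκ hBs hK0 hK hroot hp τ)),
      fun ω hω => by_contra fun hcon => hω hcon⟩
  set good : Set Ω := {ω | |IER P α γ q₁ lfdrHat D X Y (τ + 1) ω - α| + |q (τ + 1) ω - q₀| ≤
        (K / p + 1) * (2 * m + (2 * K + 1) * ε / A + gbar +
          (1 - A * gmin) ^ N * (c + 1 + m)) + (2 * K + 1) * ε / p} with hgood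
  -- A covering of the whole space needs only subadditivity, so none of these sets has to be
  -- measurable.
  have hcover : Set.univ ⊆ good ∪ U ∪ B₁ ∪ B₂ ∪ B₃ ∪ Z := by
    intro ω _
    by_contra hcon
    simp only [Set.mem_union, not_or] at hcon
    obtain ⟨⟨⟨⟨⟨hng, hnU⟩, hn₁⟩, hn₂⟩, hn₃⟩, hnZ⟩ := hcon
    refine hng ?_
    have herr : ∀ k, u ≤ k → k ≤ τ → ∫ z, |lfdrHat (k + 1) ω z.1 - lfdr μ z.1| ∂μ ≤ ε ^ 2 := by
      intro k hk hk'
      by_contra hlt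
      exact hn₁ ⟨k, Finset.mem_Icc.2 ⟨hk, hk'⟩, (not_le.1 hlt).le⟩
    have hqr : ∀ k, u ≤ k → q (k + 1) ω ≤ r := fun k hk => hU ω hnU (k + 1) (by omega)
    have hsel : ∀ k, u ≤ k → k ≤ τ → p ≤ selProb μ (lfdrHat (k + 1) ω) (q (k + 1) ω) := by
      intro k hk hk'
      have h1 := (abs_le.1 (abs_selProb_sub_le h hK0 hK (S.measurable_hat_section k ω)
        (S.hat_mem k ω) hε (herr k hk hk') (q (k + 1) ω))).1
      have h2 : (oracleLaw μ).real (Set.Ioi r) ≤ (oracleLaw μ).real (Set.Ioi (q (k + 1) ω)) :=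
        measureReal_mono (Set.Ioi_subset_Ioi (hqr k hk))
      linarith
    have hcount : t * (p / 16) ≤ counter α γ q₁ lfdrHat X Y (s + 1) ω := by
      have h1 : ¬ (counter α γ q₁ lfdrHat X Y (u + k₀ + 1) ω : ℝ) < k₀ * p / 2 := fun hlt =>
        hn₂ ⟨fun i hi => hsel (u + i) (by omega) (by omega), hlt⟩
      rw [← hk₀, not_lt] at h1
      refine le_trans ?_ h1
      nlinarith
    have hg : ∀ i, i < N → gmin ≤ γ (counter α γ q₁ lfdrHat X Y (s + i + 1) ω) ∧
        γ (counter α γ q₁ lfdrHat X Y (s + i + 1) ω) ≤ gbar := by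
      intro i hi
      have h1 := one_le_counter (α := α) (γ := γ) (q₁ := q₁) (lfdrHat := lfdrHat) (X := X) (Y := Y)
        (s + i) ω
      have h2 : counter α γ q₁ lfdrHat X Y (s + i + 1) ω ≤ τ + 1 :=
        (counter_le (s + i) ω).trans (by omega)
      have h3 : counter α γ q₁ lfdrHat X Y (s + 1) ω ≤ counter α γ q₁ lfdrHat X Y (s + i + 1) ω :=
        counter_mono ω (Nat.le_add_right s i)
      have h1' : (0 : ℝ) < counter α γ q₁ lfdrHat X Y (s + i + 1) ω := by exact_mod_cast h1
      have h2' : (counter α γ q₁ lfdrHat X Y (s + i + 1) ω : ℝ) ≤ t := by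
        rw [ht]; exact_mod_cast h2
      have h3' : (counter α γ q₁ lfdrHat X Y (s + 1) ω : ℝ) ≤
        counter α γ q₁ lfdrHat X Y (s + i + 1) ω := by exact_mod_cast h3
      rw [hγ _ h1, hgmin, hgbar]
      constructor
      · exact mul_le_mul_of_nonneg_left
          (Real.rpow_le_rpow_of_nonpos h1' h2' (neg_nonpos.2 hβ.le)) hc.le
      · refine mul_le_mul_of_nonneg_left
          (Real.rpow_le_rpow_of_nonpos (by positivity) ?_ (neg_nonpos.2 hβ.le)) hc.le
        linarith
    have hM : ∀ k ≤ N, |∑ i ∈ Finset.range k, γ (counter α γ q₁ lfdrHat X Y (s + i + 1) ω) *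
        (incrAt α q lfdrHat (s + i) (ω, (X (s + i + 1) ω, Y (s + i + 1) ω)) -
          ∫ z, incrAt α q lfdrHat (s + i) (ω, z) ∂μ)| ≤ m := by
      intro k hk
      have h1 : ¬ m ≤ _ := fun hlt => hn₃ ⟨k, hk, hlt⟩
      refine le_of_eq_of_le (congrArg _ (Finset.sum_congr rfl fun i hi => ?_)) (not_le.1 h1).le
      rw [min_eq_left (hg i (by have := Finset.mem_range.1 hi; omega)).2]
    have hx := S.abs_threshold_sub_le hα h hκ hK0 hK hq₀ hr hA hc.le hdrift₁ hdrift₂ (ω := ω)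
      (s := s) hNpos hε hm0 hgmin0
      (fun k => neg_le_threshold hc.le hα hq₁ hγ0 hγc k ω)
      (fun i hi => hqr (s + i) (by omega)) (fun i hi => herr (s + i) (by omega) (by omega))
      hM hg hgA
    rw [hsN, ← hqdef] at hx
    have hI := hZ ω hnZ ε hε (herr τ (by omega) le_rfl) (hsel τ (by omega) le_rfl)
    change |IER P α γ q₁ lfdrHat D X Y (τ + 1) ω - α| + |q (τ + 1) ω - q₀| ≤ _
    set B := 2 * m + (2 * K + 1) * ε / A + gbar + (1 - A * gmin) ^ N * (c + 1 + m)
    have h5 : (K / p + 1) * |q (τ + 1) ω - q₀| ≤ (K / p + 1) * B :=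
      mul_le_mul_of_nonneg_left hx (by positivity)
    have h6 : (K * |q (τ + 1) ω - q₀| + (2 * K + 1) * ε) / p =
      K / p * |q (τ + 1) ω - q₀| + (2 * K + 1) * ε / p := by ring
    rw [h6] at hI
    linarith
  have h1 := measureReal_mono hcover (measure_ne_top P _)
  rw [probReal_univ] at h1
  have h2 := measureReal_union_le (μ := P) (good ∪ U ∪ B₁ ∪ B₂ ∪ B₃) Z
  have h3 := measureReal_union_le (μ := P) (good ∪ U ∪ B₁ ∪ B₂) B₃
  have h4 := measureReal_union_le (μ := P) (good ∪ U ∪ B₁) B₂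
  have h5 := measureReal_union_le (μ := P) (good ∪ U) B₁
  have h6 := measureReal_union_le (μ := P) good U
  have h7 : (66 + 256 / p ^ 2) / t = 64 / t + 256 / p ^ 2 / t + 2 / t := by ring
  rw [h7]
  linarith

end IsStream

/-! ### Comparison of rates -/

open Filter Topology in
theorem tendsto_log_rpow_mul_rpow_neg (a : ℝ) {b : ℝ} (hb : 0 < b) :
    Tendsto (fun t : ℕ => Real.log t ^ a * (t : ℝ) ^ (-b)) atTop (𝓝 0) := by
  have h := ((isLittleO_log_rpow_rpow_atTop a hb).tendsto_div_nhds_zero).comp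
    tendsto_natCast_atTop_atTop
  refine h.congr fun t => ?_
  rw [Function.comp_apply, Real.rpow_neg (Nat.cast_nonneg t), div_eq_mul_inv]

theorem sq_rate {C ν₀ ν t : ℝ} (hC : 0 ≤ C) (ht : 1 ≤ t) :
    (Real.sqrt (C * 4 ^ ν) * (Real.log t ^ (ν₀ / 2) * t ^ (-ν / 2))) ^ 2 =
      C * 4 ^ ν * (Real.log t ^ ν₀ * t ^ (-ν)) := by
  have h0 : 0 ≤ Real.log t := Real.log_nonneg ht
  rw [mul_pow, mul_pow, Real.sq_sqrt (by positivity), ← Real.rpow_natCast (Real.log t ^ _),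
    ← Real.rpow_natCast (t ^ _), ← Real.rpow_mul h0, ← Real.rpow_mul (by linarith)]
  norm_num

/-- One `ε`, taken at the final time `t`, must serve all times in `[t/4, t]`; going back to `t/4`
costs `4 ^ ν`. The square appears because a mean error `ε²` gives a selection error of order `ε`. -/
theorem rate_le_sq_rate {C ν₀ ν t x : ℝ} (hC : 0 ≤ C) (hν₀ : 0 ≤ ν₀) (hν : 0 ≤ ν) (hx : 1 ≤ x)
    (hxt : x ≤ t) (htx : t / 4 ≤ x) : C * Real.log x ^ ν₀ * x ^ (-ν) ≤
      (Real.sqrt (C * 4 ^ ν) * (Real.log t ^ (ν₀ / 2) * t ^ (-ν / 2))) ^ 2 := by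
  have ht : 1 ≤ t := hx.trans hxt
  rw [sq_rate hC ht]
  have h1 : Real.log x ^ ν₀ ≤ Real.log t ^ ν₀ :=
    Real.rpow_le_rpow (Real.log_nonneg hx) (Real.log_le_log (by linarith) hxt) hν₀
  have h2 : x ^ (-ν) ≤ 4 ^ ν * t ^ (-ν) := by
    refine (Real.rpow_le_rpow_of_nonpos (by linarith) htx (neg_nonpos.2 hν)).trans (le_of_eq ?_)
    rw [Real.div_rpow (by linarith) (by norm_num), Real.rpow_neg (by norm_num : (0 : ℝ) ≤ 4),
      div_inv_eq_mul, mul_comm]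
  have h3 : 0 ≤ Real.log t ^ ν₀ := Real.rpow_nonneg (Real.log_nonneg ht) _
  have h4 : 0 ≤ x ^ (-ν) := Real.rpow_nonneg (by linarith) _
  calc C * Real.log x ^ ν₀ * x ^ (-ν) = C * (Real.log x ^ ν₀ * x ^ (-ν)) := by ring
    _ ≤ C * (Real.log t ^ ν₀ * (4 ^ ν * t ^ (-ν))) :=
        mul_le_mul_of_nonneg_left (mul_le_mul h1 h2 h4 h3) hC
    _ = _ := by ring

theorem cubic_bound_le {t x : ℝ} (hx : 0 < x) (ht : 1 ≤ t) (htx : t / 4 ≤ x) :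
    3 / (Real.pi ^ 2 * x ^ 3) ≤ 64 / t ^ 2 := by
  have hpi : 3 ≤ Real.pi ^ 2 := by nlinarith [Real.pi_gt_three]
  have h1 : t ^ 3 / 64 ≤ x ^ 3 := by
    have := pow_le_pow_left₀ (by linarith) htx 3
    linarith [show (t / 4) ^ 3 = t ^ 3 / 64 by ring]
  have h2 : t ^ 2 ≤ t ^ 3 := pow_le_pow_right₀ ht (by norm_num)
  rw [div_le_div_iff₀ (by positivity) (by positivity)]
  nlinarith [mul_le_mul hpi h1 (by positivity) (by positivity)]

/-- The contraction over a fixed fraction of the first `t` steps is polynomially small. -/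
theorem pow_contraction_le {A c β t : ℝ} {N : ℕ} (hA : 0 < A) (hc : 0 < c) (ht : 0 < t)
    (hN : t / 4 ≤ N) (h1 : A * (c * t ^ (-β)) ≤ 1) :
    (1 - A * (c * t ^ (-β))) ^ N ≤ 4 / (A * c) * t ^ (β - 1) := by
  have h2 : (1 - A * (c * t ^ (-β))) ^ N ≤ Real.exp (-(A * c / 4 * t ^ (1 - β))) := by
    refine (pow_le_pow_left₀ (by linarith)
      (Real.one_sub_le_exp_neg (A * (c * t ^ (-β)))) N).trans ?_
    rw [← Real.exp_nat_mul, Real.exp_le_exp, mul_neg, neg_le_neg_iff, sub_eq_add_neg 1 β,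
      Real.rpow_add ht, Real.rpow_one]
    have := mul_le_mul_of_nonneg_right hN (show 0 ≤ A * (c * t ^ (-β)) by positivity)
    linarith
  -- Crude, but `exp (-y) ≤ 1 / y` already yields the term `t^(β-1)` of the claimed rate.
  refine h2.trans ((exp_neg_le_inv (by positivity)).trans (le_of_eq ?_))
  rw [mul_inv, ← Real.rpow_neg ht.le, neg_sub, inv_div]

theorem step_mul_sqrt_eq {c p β t : ℝ} (hp : 0 < p) (ht : 1 ≤ t) :
    4 * (c * (p / 16 * t) ^ (-β)) * Real.sqrt (t * Real.log t) =
      4 * (c * (p / 16) ^ (-β)) * (Real.log t ^ (1 / 2 : ℝ) * t ^ (1 / 2 - β)) := by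
  have ht0 : 0 < t := by linarith
  rw [Real.mul_rpow (by positivity) ht0.le, Real.sqrt_mul ht0.le, Real.sqrt_eq_rpow,
    Real.sqrt_eq_rpow, sub_eq_add_neg, Real.rpow_add ht0]
  ring

theorem step_le {c p β t : ℝ} (hc : 0 < c) (hp : 0 < p) (ht : 1 ≤ t) (hlog : 1 ≤ Real.log t) :
    c * (p / 16 * t) ^ (-β) ≤
      4 * (c * (p / 16) ^ (-β)) * (Real.log t ^ (1 / 2 : ℝ) * t ^ (1 / 2 - β)) := by
  rw [← step_mul_sqrt_eq hp ht]
  have h1 : 1 ≤ Real.sqrt (t * Real.log t) :=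
    Real.one_le_sqrt.2 (one_le_mul_of_one_le_of_one_le ht hlog)
  have h2 : 0 ≤ c * (p / 16 * t) ^ (-β) := by positivity
  nlinarith

/-- Below `Bs` the event `W > q` has positive mass, so the equation for the conditional mean is the
root equation for the drift, which is strictly decreasing on `[κ, 1 - α]`. -/
theorem existsUnique_meanAbove {d : ℕ} {μ : Measure (Example d)} [IsProbabilityMeasure μ]
    {f : ℝ → ℝ} {κ Bs α : ℝ} (h : HasDensityOn (oracleLaw μ) f κ Bs) (hκ : 0 ≤ κ) (hκB : κ < Bs)
    (hB : Bs ≤ 1) (hαB : 1 - Bs < α)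
    (hα0 : α < μ.real {z | z.2 = 0}) :
    ∃ q₀ : ℝ, q₀ ∈ Set.Ioo κ (1 - α) ∧ tailDrift (oracleLaw μ) (1 - α) q₀ = 0 ∧
      ∀ q : ℝ, (q ∈ Set.Ioo κ (1 - α) ∧ meanAbove μ q = 1 - α) ↔ q = q₀ := by
  have hpos : 0 < tailDrift (oracleLaw μ) (1 - α) κ := by
    rw [tailDrift_left h]; linarith
  -- Not assumed, but forced: otherwise `1 - α - w` would be nonpositive above `κ`, against the
  -- positive drift there.
  have hκα : κ < 1 - α := by
    by_contra hcon
    refine absurd hpos (not_lt.2 (setIntegral_nonpos measurableSet_Ioi fun w hw => ?_))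
    have : κ < w := hw
    linarith
  obtain ⟨q₀, hq₀, hroot⟩ := h.exists_root hκ hB (a := 1 - α)
    ⟨by linarith, by linarith⟩ hκα (by linarith) hpos
  refine ⟨q₀, hq₀, hroot, fun q => ⟨fun ⟨hq, hmean⟩ => ?_, ?_⟩⟩
  · rw [meanAbove_eq_iff h hκB (by linarith [hq.2])] at hmean
    rcases lt_trichotomy q q₀ with hlt | heq | hlt
    · have := h.tailDrift_strictAnti hq.1.le hlt hq₀.2.le (by linarith [hq₀.2])
      linarith
    · exact heq
    · have := h.tailDrift_strictAnti hq₀.1.le hlt hq.2.le (by linarith [hq.2])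
      linarith
  · rintro rfl
    exact ⟨hq₀, (meanAbove_eq_iff h hκB (by linarith [hq₀.2]) _).2 hroot⟩

end OnlineTesting

/-! ### The main theorem -/

theorem mainTheorem11
    {Ω : Type*} [MeasurableSpace Ω] (P : Measure Ω) [IsProbabilityMeasure P]
    {d n : ℕ}
    -- the law of `(X, Y)`, the holdout sample, and the online stream `(X_t, Y_t)`, `t ≥ 1`
    (μ : Measure (OnlineTesting.Example d)) [IsProbabilityMeasure μ]
    (D : Fin n → Ω → OnlineTesting.Example d)
    (X : ℕ → Ω → OnlineTesting.Feature d) (Y : ℕ → Ω → Fin 2)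
    (hD : ∀ i, Measurable (D i)) (hX : ∀ t, Measurable (X t)) (hY : ∀ t, Measurable (Y t))
    (hlaw : ∀ t, 1 ≤ t → P.map (fun ω => (X t ω, Y t ω)) = μ)
    (hindep : iIndepFun (fun (k : ℕ) (ω : Ω) => (X (k + 1) ω, Y (k + 1) ω)) P)
    (hholdout : IndepFun (fun ω i => D i ω) (fun ω (k : ℕ) => (X (k + 1) ω, Y (k + 1) ω)) P)
    -- the law of `1 - lfdr(X)`
    (κ Bs : ℝ) (hκ : 0 ≤ κ) (hκB : κ < Bs) (hB : Bs ≤ 1)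
    (hdens : OnlineTesting.HasContinuousDensityOn μ κ Bs)
    -- the estimators of `lfdr`
    (lfdrHat : ℕ → Ω → OnlineTesting.Feature d → ℝ)
    (hhat_meas : ∀ t, 1 ≤ t →
      Measurable[(OnlineTesting.history D X Y (t - 1)).prod inferInstance]
        (fun p : Ω × OnlineTesting.Feature d => lfdrHat t p.1 p.2))
    (hhat_range : ∀ t, 1 ≤ t → ∀ ω x, lfdrHat t ω x ∈ Set.Icc (0 : ℝ) 1)
    (ν₀ ν : ℝ) (hν₀ : 0 < ν₀) (hν : 0 < ν)
    (hest : OnlineTesting.EstimationRate P μ lfdrHat D X Y ν₀ ν)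
    -- the error level, the steps `c j^(-β)` and the starting point
    (α : ℝ) (hα : α ∈ Set.Ioo (0 : ℝ) 1) (hαB : 1 - Bs < α) (hα0 : α < μ.real {z | z.2 = 0})
    (c β q₁ : ℝ) (hc : 0 < c) (hβ : β ∈ Set.Ioo (1 / 2 : ℝ) 1) (hq₁ : q₁ ∈ Set.Icc 0 (1 - α))
    (γ : ℕ → ℝ) (hγ : ∀ j : ℕ, 1 ≤ j → γ j = c * (j : ℝ) ^ (-β)) :
    ∃ q₀ : ℝ,
      (∀ q : ℝ, (q ∈ Set.Ioo κ (1 - α) ∧ OnlineTesting.meanAbove μ q = 1 - α) ↔ q = q₀) ∧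
      ∀ δ' : ℝ,
        OnlineTesting.failureProb P (OnlineTesting.threshold α γ q₁ lfdrHat X Y) Bs < δ' →
        ∃ T₀ : ℕ, 1 ≤ T₀ ∧ ∃ C₀ : ℝ, 0 < C₀ ∧ ∀ t : ℕ, T₀ ≤ t →
          1 - δ' - C₀ / t ≤
            P.real {ω |
              |OnlineTesting.IER P α γ q₁ lfdrHat D X Y t ω - α| +
                  |OnlineTesting.threshold α γ q₁ lfdrHat X Y t ω - q₀| ≤
                C₀ * ((Real.log t ^ (1 / 2 : ℝ) * (t : ℝ) ^ (1 / 2 - β) + (t : ℝ) ^ (β - 1)) +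
                  Real.log t ^ (ν₀ / 2) * (t : ℝ) ^ (-ν / 2))} := by
  obtain ⟨f, hf, hfc, hfp, hfz⟩ := hdens
  have h : OnlineTesting.HasDensityOn (OnlineTesting.oracleLaw μ) f κ Bs := ⟨hf, hfc, hfp, hfz⟩
  have S : OnlineTesting.IsStream P μ D X Y lfdrHat :=
    ⟨hD, hX, hY, fun t => hlaw (t + 1) (Nat.le_add_left 1 t),
      fun t => OnlineTesting.indep_history hD hX hY hindep hholdout t,
      fun t => hhat_meas (t + 1) (Nat.le_add_left 1 t),
      fun t => hhat_range (t + 1) (Nat.le_add_left 1 t)⟩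
  obtain ⟨q₀, hq₀, hroot, huniq⟩ :=
    OnlineTesting.existsUnique_meanAbove h hκ hκB hB hαB hα0
  refine ⟨q₀, huniq, fun δ' hδ' => ?_⟩
  rw [OnlineTesting.failureProb] at hδ'
  -- As `δ'` exceeds the infimum, some level `r < Bs` and time `t₀` already have failure probability
  -- below `δ'`; the pair `r = 0`, `t = 1` shows that the set is nonempty.
  obtain ⟨_, ⟨r, hr, t₀, -, rfl⟩, hUδ⟩ := exists_lt_of_csInf_lt
    (by exact ⟨_, 0, ⟨le_rfl, hκ.trans_lt hκB⟩, 1, le_rfl, rfl⟩) hδ'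
  set U : Set Ω := {ω | (r : EReal) < ⨆ (T : ℕ) (_ : t₀ ≤ T),
    ((OnlineTesting.threshold α γ q₁ lfdrHat X Y T ω : ℝ) : EReal)} with hUdef
  have hU : ∀ ω ∉ U, ∀ T, t₀ ≤ T → OnlineTesting.threshold α γ q₁ lfdrHat X Y T ω ≤ r := by
    intro ω hω T hT
    rw [← EReal.coe_le_coe_iff]
    exact (le_iSup₂ (f := fun (T : ℕ) (_ : t₀ ≤ T) =>
      ((OnlineTesting.threshold α γ q₁ lfdrHat X Y T ω : ℝ) : EReal)) T hT).trans (not_lt.1 hω)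
  obtain ⟨K, hK0, hK⟩ := h.exists_bound
  obtain ⟨A, hA, hdrift₁, hdrift₂⟩ := h.exists_linear_drift hq₀ (by linarith) hroot hr.2 c
  have hr_pos := h.real_Ioi_pos hκB hr.2
  set p := (OnlineTesting.oracleLaw μ).real (Set.Ioi r) / 2 with hpdef
  have hp : 0 < p := by positivity
  obtain ⟨C₁, hC₁, T₁, hest⟩ := hest
  have hβ0 : 0 < β := by linarith [hβ.1]
  set e₀ := Real.sqrt (C₁ * 4 ^ ν) with he₀
  have he₀pos : 0 < e₀ := Real.sqrt_pos.2 (by positivity)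
  set m₀ := 4 * (c * (p / 16) ^ (-β)) with hm₀
  have hm₀pos : 0 < m₀ := by positivity
  have ev₁ := (OnlineTesting.tendsto_log_rpow_mul_rpow_neg (1 / 2) (b := β - 1 / 2)
    (by linarith [hβ.1])).const_mul m₀
  have ev₂ := (OnlineTesting.tendsto_log_rpow_mul_rpow_neg (ν₀ / 2) (b := ν / 2)
    (by linarith)).const_mul ((2 * K + 1) * e₀)
  have ev₃ := ((OnlineTesting.tendsto_log_rpow_mul_rpow_neg 0 hβ0).const_mul
    (A * (c * (p / 16) ^ (-β))))
  have ev₄ := ((OnlineTesting.tendsto_log_rpow_mul_rpow_neg 0 hβ0).const_mul (A * c))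
  rw [mul_zero] at ev₁ ev₂ ev₃ ev₄
  have ev₅ : Filter.Tendsto (fun t : ℕ => Real.log t) Filter.atTop Filter.atTop :=
    Real.tendsto_log_atTop.comp tendsto_natCast_atTop_atTop
  -- For large `t`: the noise bound is at most `1`, the selection error is at most `p`, `A * gbar ≤
  -- 1`, `A * gmin ≤ 1`, `log t ≥ 1`, and a quarter of the time span lies beyond both `t₀` and `T₁`.
  obtain ⟨T₀, hT₀⟩ := Filter.eventually_atTop.1
    ((ev₁.eventually_le_const one_pos).and ((ev₂.eventually_le_const hp).and
      ((ev₃.eventually_le_const one_pos).and ((ev₄.eventually_le_const one_pos).and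
        ((ev₅.eventually_ge_atTop 1).and (Filter.eventually_ge_atTop (4 * (t₀ + T₁) + 6)))))))
  -- One constant for the probability and for the rate. In `3 * m₀`, two parts are the noise and one
  -- is the step size; `c + 2` bounds `c + 1 + m`, since the noise bound `m` is at most `1`.
  set C₀ := (66 + 256 / p ^ 2) + (K / p + 1) * (3 * m₀ + (2 * K + 1) * e₀ / A +
    4 / (A * c) * (c + 2)) + (2 * K + 1) * e₀ / p with hC₀
  refine ⟨max 1 T₀, le_max_left _ _, C₀, by positivity, fun t ht => ?_⟩
  obtain ⟨b₁, b₂, b₃, b₄, b₅, b₆⟩ := hT₀ t ((le_max_right _ _).trans ht)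
  obtain ⟨τ, rfl⟩ : ∃ τ, t = τ + 1 := ⟨t - 1, by omega⟩
  simp only [Real.rpow_zero, one_mul] at b₃ b₄
  rw [neg_sub] at b₁
  rw [← neg_div] at b₂
  push_cast at b₁ b₂ b₃ b₄ b₅ ⊢
  set x : ℝ := (τ : ℝ) + 1 with hx
  have hx1 : 1 ≤ x := by rw [hx]; linarith [(Nat.cast_nonneg τ : (0 : ℝ) ≤ τ)]
  have hx0 : 0 < x := by linarith
  set R₁ := Real.log x ^ (1 / 2 : ℝ) * x ^ (1 / 2 - β) with hR₁
  set R₂ := x ^ (β - 1) with hR₂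
  set R₃ := Real.log x ^ (ν₀ / 2) * x ^ (-ν / 2) with hR₃
  have hlog : 0 < Real.log x := by linarith
  have hR₁0 : 0 < R₁ := by positivity
  have hR₂0 : 0 < R₂ := by positivity
  have hR₃0 : 0 < R₃ := by positivity
  have hεpos : 0 < e₀ * R₃ := by positivity
  have hest' : ∀ k ∈ Finset.Icc (τ / 4) τ, P.real {ω | (e₀ * R₃) ^ 2 ≤
      (condExp (OnlineTesting.history D X Y k) P fun ω' =>
        |lfdrHat (k + 1) ω' (X (k + 1) ω') - OnlineTesting.lfdr μ (X (k + 1) ω')|) ω} ≤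
      64 / ((τ : ℝ) + 1) ^ 2 := by
    intro k hk
    obtain ⟨hk1, hk2⟩ := Finset.mem_Icc.1 hk
    have hk3 : x / 4 ≤ ((k + 1 : ℕ) : ℝ) := by
      have : ((τ + 1 : ℕ) : ℝ) ≤ (4 * (k + 1) : ℕ) := by exact_mod_cast (by omega)
      push_cast at this ⊢
      linarith
    have hk4 : ((k + 1 : ℕ) : ℝ) ≤ x := by rw [hx]; exact_mod_cast Nat.succ_le_succ hk2
    have hk5 : (1 : ℝ) ≤ ((k + 1 : ℕ) : ℝ) := by exact_mod_cast Nat.le_add_left 1 k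
    refine le_trans (measureReal_mono (fun ω hω => ?_) (measure_ne_top P _))
      ((hest (k + 1) (by omega)).trans (OnlineTesting.cubic_bound_le (by linarith) hx1 hk3))
    exact (OnlineTesting.rate_le_sq_rate hC₁.le hν₀.le hν.le hk5 hk4 hk3).trans hω
  have hgA : A * (c * (p / 16 * x) ^ (-β)) ≤ 1 := by
    rw [Real.mul_rpow (by positivity) hx0.le]
    linarith
  have key := S.le_real_error_le (γ := γ) (q₁ := q₁) hα h hκ hB hK0.le hK
    (q₀ := q₀) ⟨hκ.trans hq₀.1.le, by linarith [hq₀.2, hα.1]⟩ (hr.2.le.trans hB) hA hroot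
    hdrift₁ hdrift₂ hc hβ0 hq₁.1 hγ hp (by linarith) hU (by omega) (by omega) hεpos
    (by linarith) hest' rfl rfl rfl hgA
  rw [← hx, OnlineTesting.step_mul_sqrt_eq hp hx1, ← hm₀, ← hR₁] at key
  have hC₀' : 66 + 256 / p ^ 2 ≤ C₀ := by
    have : 0 ≤ (K / p + 1) * (3 * m₀ + (2 * K + 1) * e₀ / A + 4 / (A * c) * (c + 2)) +
      (2 * K + 1) * e₀ / p := by positivity
    linarith
  have hdiv : (66 + 256 / p ^ 2) / x ≤ C₀ / x := div_le_div_of_nonneg_right hC₀' hx0.le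
  refine le_trans (by linarith) (key.trans (measureReal_mono (fun ω hω => ?_)
    (measure_ne_top P _)))
  rw [Set.mem_ofPred_eq] at hω ⊢
  refine hω.trans ?_
  have g₁ : c * (p / 16 * x) ^ (-β) ≤ m₀ * R₁ := OnlineTesting.step_le hc hp hx1 b₅
  have g₂ : (1 - A * (c * x ^ (-β))) ^ (τ - τ / 2) ≤ 4 / (A * c) * R₂ := by
    refine OnlineTesting.pow_contraction_le hA hc hx0 ?_ (by linarith)
    have : ((τ + 1 : ℕ) : ℝ) ≤ (4 * (τ - τ / 2) : ℕ) := by exact_mod_cast (by omega)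
    rw [Nat.cast_mul] at this
    push_cast at this
    linarith
  have g₃ : (1 - A * (c * x ^ (-β))) ^ (τ - τ / 2) * (c + 1 + m₀ * R₁) ≤
      4 / (A * c) * R₂ * (c + 2) :=
    mul_le_mul g₂ (by linarith) (by positivity) (by positivity)
  have g₄ : 2 * (m₀ * R₁) + (2 * K + 1) * (e₀ * R₃) / A + c * (p / 16 * x) ^ (-β) +
      (1 - A * (c * x ^ (-β))) ^ (τ - τ / 2) * (c + 1 + m₀ * R₁) ≤
      (3 * m₀ + (2 * K + 1) * e₀ / A + 4 / (A * c) * (c + 2)) * (R₁ + R₂ + R₃) := by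
    have j₁ : 0 ≤ 3 * m₀ * (R₂ + R₃) := by positivity
    have j₂ : 0 ≤ (2 * K + 1) * e₀ / A * (R₁ + R₂) := by positivity
    have j₃ : 0 ≤ 4 / (A * c) * (c + 2) * (R₁ + R₃) := by positivity
    have j₄ : (2 * K + 1) * (e₀ * R₃) / A = (2 * K + 1) * e₀ / A * R₃ := by ring
    rw [j₄]
    linarith
  have g₅ : (2 * K + 1) * (e₀ * R₃) / p ≤ (2 * K + 1) * e₀ / p * (R₁ + R₂ + R₃) := by
    have j₁ : 0 ≤ (2 * K + 1) * e₀ / p * (R₁ + R₂) := by positivity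
    have j₂ : (2 * K + 1) * (e₀ * R₃) / p = (2 * K + 1) * e₀ / p * R₃ := by ring
    rw [j₂]
    linarith
  have g₆ := mul_le_mul_of_nonneg_left g₄ (show 0 ≤ K / p + 1 by positivity)
  have g₇ : 0 ≤ (66 + 256 / p ^ 2) * (R₁ + R₂ + R₃) := by positivity
  rw [hC₀]
  linarith
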